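/- An election consists of a finite set $C$ of $m$ candidates and a list of $n$ voters, each with a strict ranking of all candidates. For a committee size $k \le m$, the SNTV (respectively Bloc, $k$-Borda) winning committees are the $k$-element subsets $S \subseteq C$ that maximize $\sum_{c \in S} s(c)$, where $s(c)$ is the total Plurality (respectively $k$-Approval, Borda) score of $c$: a voter who ranks $c$ in position $i \in \{1,\dots,m\}$ contributes $1$ if $i \le 1$ and $0$ otherwise (respectively $1$ if $i \le k$ and $0$ otherwise; $m-i$). For a multiwinner rule $\mathcal{R}$, the $\mathcal{R}$ Robustness Radius problem is the following decision problem: given an election $E$, a committee size $k$ and an integer $B \ge 0$, is it possible to obtain, by at most $B$ swaps of adjacent candidates within the rankings of $E$, an election $E'$ whose set of winning committees of size $k$ differs from that of $E$, i.e. $\mathcal{R}(E',k) \ne \mathcal{R}(E,k)$? The $\mathcal{R}$ Robustness Radius problem is solvable in polynomial time for each of the three rules $\mathcal{R} \in \{\text{SNTV}, \text{Bloc}, k\text{-Borda}\}$. -/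

import Mathlib

namespace Multiwinner

/-- A preference order over the candidates `0, …, m - 1`, as a bijection from positions to
candidates: `v i` is the candidate on the `i`-th place, `i = 0` being the top place. -/
abbrev Ranking (m : ℕ) : Type := Fin m ≃ Fin m

/-- An election with candidate set `Fin m` and voters `0, …, n - 1`. -/
abbrev Election (m n : ℕ) : Type := Fin n → Ranking m

/-- The position of candidate `c` in the ranking `v`; the top-ranked candidate has position 1. -/
def pos {m : ℕ} (v : Ranking m) (c : Fin m) : ℕ := (v.symm c : ℕ) + 1

/-- The Borda scoring function for `m` candidates (applied to positions `1, …, m`). -/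
def borda (m : ℕ) (i : ℕ) : ℤ := (m : ℤ) - (i : ℤ)

/-- The `t`-Approval scoring function; `t = 1` is Plurality. -/
def approval (t : ℕ) (i : ℕ) : ℤ := if i ≤ t then 1 else 0

/-- The `γ`-score of a candidate. -/
def score {m n : ℕ} (γ : ℕ → ℤ) (E : Election m n) (c : Fin m) : ℤ :=
  ∑ v : Fin n, γ (pos (E v) c)

/-- The score of a committee: the sum of the scores of its members. -/
def committeeScore {m n : ℕ} (γ : ℕ → ℤ) (E : Election m n) (S : Finset (Fin m)) : ℤ :=
  ∑ c ∈ S, score γ E c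

/-- The size-`k` committees with the highest score. -/
def bestCommittees {m n : ℕ} (γ : ℕ → ℤ) (E : Election m n) (k : ℕ) : Set (Finset (Fin m)) :=
  {S | S.card = k ∧ ∀ T : Finset (Fin m), T.card = k → committeeScore γ E T ≤ committeeScore γ E S}

/-- A multiwinner voting rule: it maps an election and a committee size to the set of (tied)
winning committees. -/
abbrev Rule : Type := ∀ ⦃m n : ℕ⦄, Election m n → ℕ → Set (Finset (Fin m))

/-- SNTV: highest total Plurality score. -/
def sntv : Rule := fun _ _ E k => bestCommittees (approval 1) E k

/-- Bloc: highest total `k`-Approval score, `k` being the committee size. -/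
def bloc : Rule := fun _ _ E k => bestCommittees (approval k) E k

/-- `k`-Borda: highest total Borda score. -/
def kBorda : Rule := fun m _ E k => bestCommittees (borda m) E k

/-- `E'` arises from `E` by swapping, in the ranking of one voter `v`, the candidates on the
adjacent places `i` and `i + 1`. -/
def AdjacentSwap {m n : ℕ} (E E' : Election m n) : Prop :=
  ∃ (v : Fin n) (i : ℕ) (h : i + 1 < m),
    E' = Function.update E v ((Equiv.swap (⟨i, Nat.lt_of_succ_lt h⟩ : Fin m) ⟨i + 1, h⟩).trans (E v))

/-- `ReachableBySwaps t E E'`: `E'` arises from `E` by exactly `t` successive adjacent swaps. -/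
inductive ReachableBySwaps {m n : ℕ} : ℕ → Election m n → Election m n → Prop
  | refl (E : Election m n) : ReachableBySwaps 0 E E
  | step {t : ℕ} {E E' E'' : Election m n} :
      ReachableBySwaps t E E' → AdjacentSwap E' E'' → ReachableBySwaps (t + 1) E E''

/-- An instance of the Robustness Radius problem: an election (with `m` candidates and `n` voters),
a committee size `k`, and a budget `B` of swaps. -/
structure Instance where
  m : ℕ
  n : ℕ
  election : Election m n
  k : ℕ
  k_le : k ≤ m
  B : ℕ

/-- The question of the Robustness Radius problem for the rule `R`: can the set of winning committees
be changed by at most `B` swaps of adjacent candidates? -/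
def RobustnessRadius (R : Rule) (I : Instance) : Prop :=
  ∃ (t : ℕ) (E' : Election I.m I.n),
    t ≤ I.B ∧ ReachableBySwaps t I.election E' ∧ R E' I.k ≠ R I.election I.k

open Computability (Γ')

/-- The number `a` in unary, ended by a comma. -/
def encodeUnary (a : ℕ) : List Γ' := List.replicate a (Γ'.bit true) ++ [Γ'.comma]

/-- The number `a` in binary (least significant bit first), ended by a comma. -/
def encodeBinary (a : ℕ) : List Γ' := (Computability.encodeNat a).map Γ'.bit ++ [Γ'.comma]

/-- A ranking, as the bracketed list of its candidates from the most to the least preferred one. -/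
def encodeRanking {m : ℕ} (v : Ranking m) : List Γ' :=
  [Γ'.bra] ++ (List.ofFn fun i : Fin m => encodeUnary (v i : ℕ)).flatten ++ [Γ'.ket]

/-- The string that represents an instance. The budget `B`, which is not bounded in terms of the
election, is written in binary. The candidate set has `m` elements and every vote lists all of
them, so that writing `m`, `k ≤ m` and the names of the candidates in unary changes the length
of the input at most quadratically. -/
def encodeInstance (I : Instance) : List Γ' :=
  encodeUnary I.m ++ encodeUnary I.k ++ encodeBinary I.B ++
    (List.ofFn fun v : Fin I.n => encodeRanking (I.election v)).flatten

/-- The decision problem `P`, whose instances are written as strings through `enc`, is solvable in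
polynomial time: a Turing machine (Mathlib's multi-stack model) decides it in a number of steps
bounded by a polynomial in the length of the input string. -/
def PolyTimeDecidable {α Γ : Type} (enc : α → List Γ) (P : α → Prop) : Prop :=
  ∃ f : α → Bool, (∀ a, f a = true ↔ P a) ∧
    Nonempty (Turing.TM2ComputableInPolyTime enc Computability.encodeBool f)

end Multiwinner

/-!
Only the order of the candidates' scores matters for the set of winning committees. This set
changes exactly if some pair of candidates `c` and `d`, such that a winning committee contains `c`
but not `d`, ends up with `d` at least as good as `c`, and strictly better if they were tied
before. For a fixed pair, a swap is relevant only through the places of `c` and `d` in the vote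
where it occurs, and the votes are independent of each other. Hence the pairs of scores that `c`
and `d` can attain with a given number of swaps are found by a dynamic program over the votes.
There are only polynomially many of them, since scores are at most `n * m`, and since `n * m ^ 2`
swaps suffice to move `c` and `d` to any places that they can reach.

A Turing machine can run this algorithm in polynomial time because the polynomial-time functions on
trees, written on a stack in prefix order, are closed under composition, pairing and folds over
lists whose intermediate results have polynomial size.
-/

/-! ### Structured stack programs -/

/-- Structured programs acting on stacks `k : K` with alphabets `Γ k` and on a memory of type `σ`.
They are the source language that is compiled to Turing machines; in `pop k f` the function `f`
receives `none` if the stack `k` is empty. -/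
inductive StackProg {K : Type} (Γ : K → Type) (σ : Type)
  | push (k : K) (f : σ → Γ k)
  | pop (k : K) (f : σ → Option (Γ k) → σ)
  | load (f : σ → σ)
  | seq (p q : StackProg Γ σ)
  | ite (f : σ → Bool) (p q : StackProg Γ σ)
  | loop (f : σ → Bool) (p : StackProg Γ σ)

namespace StackProg

open Turing StateTransition

variable {K : Type} {Γ : K → Type} {σ : Type}

/-- `Run p v S t v' S'`: the program `p`, started with memory `v` and stacks `S`, ends within `t`
steps with memory `v'` and stacks `S'`. -/
inductive Run [DecidableEq K] :
    StackProg Γ σ → σ → (∀ k, List (Γ k)) → ℕ → σ → (∀ k, List (Γ k)) → Prop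
  | push {k f v S} : Run (.push k f) v S 1 v (Function.update S k (f v :: S k))
  | pop {k f v S} : Run (.pop k f) v S 1 (f v (S k).head?) (Function.update S k (S k).tail)
  | load {f v S} : Run (.load f) v S 1 (f v) S
  | seq {p q v₀ S₀ t₁ v₁ S₁ t₂ v₂ S₂} :
      Run p v₀ S₀ t₁ v₁ S₁ → Run q v₁ S₁ t₂ v₂ S₂ → Run (.seq p q) v₀ S₀ (t₁ + t₂) v₂ S₂
  | ite_true {f p q v S t v' S'} :
      f v = true → Run p v S t v' S' → Run (.ite f p q) v S (t + 1) v' S'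
  | ite_false {f p q v S t v' S'} :
      f v = false → Run q v S t v' S' → Run (.ite f p q) v S (t + 1) v' S'
  | loop_done {f p v S} : f v = false → Run (.loop f p) v S 1 v S
  | loop_step {f p v₀ S₀ t₁ v₁ S₁ t₂ v₂ S₂} :
      f v₀ = true → Run p v₀ S₀ t₁ v₁ S₁ → Run (.loop f p) v₁ S₁ t₂ v₂ S₂ →
        Run (.loop f p) v₀ S₀ (t₁ + t₂ + 1) v₂ S₂
  | mono {p v S t t' v' S'} : Run p v S t v' S' → t ≤ t' → Run p v S t' v' S'

/-- The program points of a program, which become the labels of its Turing machine. -/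
def Label : StackProg Γ σ → Type
  | .push _ _ => Unit
  | .pop _ _ => Unit
  | .load _ => Unit
  | .seq p q => Label p ⊕ Label q
  | .ite _ p q => Option (Label p ⊕ Label q)
  | .loop _ p => Option (Label p)

instance Label.instFintype : ∀ p : StackProg Γ σ, Fintype (Label p)
  | .push _ _ => inferInstanceAs (Fintype Unit)
  | .pop _ _ => inferInstanceAs (Fintype Unit)
  | .load _ => inferInstanceAs (Fintype Unit)
  | .seq p q =>
    letI := Label.instFintype p
    letI := Label.instFintype q
    inferInstanceAs (Fintype (Label p ⊕ Label q))
  | .ite _ p q =>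
    letI := Label.instFintype p
    letI := Label.instFintype q
    inferInstanceAs (Fintype (Option (Label p ⊕ Label q)))
  | .loop _ p =>
    letI := Label.instFintype p
    inferInstanceAs (Fintype (Option (Label p)))

/-- The program point at which a program starts. -/
def entry : ∀ p : StackProg Γ σ, Label p
  | .push _ _ => ()
  | .pop _ _ => ()
  | .load _ => ()
  | .seq p _ => Sum.inl (entry p)
  | .ite _ _ _ => none
  | .loop _ _ => none

/-- The statement that continues at a label `e`, or halts if `e = none`. -/
def exitStmt {Λ : Type} : Option Λ → TM2.Stmt Γ Λ σ
  | none => .halt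
  | some l => .goto fun _ => l

/-- The statement at a program point. Here `inj` embeds the program points into the labels of a
larger machine and `e` is the label at which to continue when the program ends, `none` for halting;
the two arguments let the code of a subprogram be the code of the program restricted to it. -/
def stmtAt {Λ : Type} : ∀ p : StackProg Γ σ, (Label p → Λ) → Option Λ → Label p → TM2.Stmt Γ Λ σ
  | .push k f, _, e, _ => .push k f (exitStmt e)
  | .pop k f, _, e, _ => .pop k f (exitStmt e)
  | .load f, _, e, _ => .load f (exitStmt e)
  | .seq p q, inj, e, l =>
    match l with
    | .inl l => stmtAt p (fun l => inj (.inl l)) (some (inj (Sum.inr (entry q)))) l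
    | .inr l => stmtAt q (fun l => inj (.inr l)) e l
  | .ite f p q, inj, e, l =>
    match l with
    | none => .branch f (exitStmt (some (inj (some (Sum.inl (entry p))))))
        (exitStmt (some (inj (some (Sum.inr (entry q))))))
    | some (.inl l) => stmtAt p (fun l => inj (some (.inl l))) e l
    | some (.inr l) => stmtAt q (fun l => inj (some (.inr l))) e l
  | .loop f p, inj, e, l =>
    match l with
    | none => .branch f (exitStmt (some (inj (some (entry p))))) (exitStmt e)
    | some l => stmtAt p (fun l => inj (some l)) (some (inj none)) l

section Run

variable [DecidableEq K] {Λ : Type} {M : Λ → TM2.Stmt Γ Λ σ} {p : StackProg Γ σ} {v v' : σ}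
  {S S' : ∀ k, List (Γ k)} {t t' : ℕ}

@[simp] theorem stepAux_exitStmt (e : Option Λ) (v : σ) (S : ∀ k, List (Γ k)) :
    TM2.stepAux (exitStmt e) v S = ⟨e, v, S⟩ := by
  cases e <;> rfl

/-- The machine `M` gets from the configuration `c` to `c'` within `t` steps. -/
def EvalsWithin (M : Λ → TM2.Stmt Γ Λ σ) (c : TM2.Cfg Γ Λ σ) (t : ℕ) (c' : TM2.Cfg Γ Λ σ) : Prop :=
  Nonempty (EvalsToInTime (TM2.step M) c (some c') t)

theorem EvalsWithin.trans {a b c : TM2.Cfg Γ Λ σ} {t₁ t₂ : ℕ}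
    (h₁ : EvalsWithin M a t₁ b) (h₂ : EvalsWithin M b t₂ c) : EvalsWithin M a (t₁ + t₂) c := by
  rw [add_comm]
  exact h₁.elim fun h₁ => h₂.elim fun h₂ => ⟨h₁.trans _ _ _ _ _ _ h₂⟩

theorem EvalsWithin.of_stepAux_eq {l : Λ} {c : TM2.Cfg Γ Λ σ}
    (h : TM2.stepAux (M l) v S = c) :
    EvalsWithin M ⟨some l, v, S⟩ 1 c :=
  ⟨⟨⟨1, congrArg some h⟩, le_rfl⟩⟩

theorem EvalsWithin.mono {a b : TM2.Cfg Γ Λ σ} (h : EvalsWithin M a t b) (ht : t ≤ t') :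
    EvalsWithin M a t' b :=
  h.elim fun h => ⟨⟨h.toEvalsTo, h.steps_le_m.trans ht⟩⟩

theorem Run.evalsWithin (h : Run p v S t v' S') :
    ∀ {Λ : Type} {M : Λ → TM2.Stmt Γ Λ σ} {inj : Label p → Λ} {e : Option Λ},
      (∀ l, M (inj l) = stmtAt p inj e l) →
        EvalsWithin M ⟨some (inj (entry p)), v, S⟩ t ⟨e, v', S'⟩ := by
  induction h with
  | push | pop | load => intro _ _ _ _ hM; exact .of_stepAux_eq (by rw [hM]; simp [stmtAt])
  | seq _ _ ih₁ ih₂ =>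
    intro _ _ _ _ hM
    exact (ih₁ fun l => hM (Sum.inl l)).trans (ih₂ fun l => hM (Sum.inr l))
  | ite_true hf _ ih =>
    intro _ _ _ _ hM
    rw [add_comm]
    refine .trans (.of_stepAux_eq ?_) (ih fun l => hM (some (.inl l)))
    rw [hM]
    simp [stmtAt, entry, hf]
  | ite_false hf _ ih =>
    intro _ _ _ _ hM
    rw [add_comm]
    refine .trans (.of_stepAux_eq ?_) (ih fun l => hM (some (.inr l)))
    rw [hM]
    simp [stmtAt, entry, hf]
  | loop_done hf =>
    intro _ _ _ _ hM
    refine .of_stepAux_eq ?_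
    rw [hM]
    simp [stmtAt, entry, hf]
  | loop_step hf _ _ ih₁ ih₂ =>
    intro _ _ _ _ hM
    rw [add_comm]
    refine .trans (.of_stepAux_eq ?_) ((ih₁ fun l => hM (some l)).trans (ih₂ hM))
    rw [hM]
    simp [stmtAt, entry, hf]
  | mono _ ht ih => intro _ _ _ _ hM; exact (ih hM).mono ht

theorem Run.sum_length_le [Fintype K] (h : Run p v S t v' S') :
    ∑ k, (S' k).length ≤ ∑ k, (S k).length + t := by
  have sum_length_update_le (S : ∀ k, List (Γ k)) (k : K) (l : List (Γ k))
      (hl : l.length ≤ (S k).length + 1) :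
      ∑ j, (Function.update S k l j).length ≤ ∑ j, (S j).length + 1 := by
    rw [← Finset.add_sum_erase _ _ (Finset.mem_univ k),
      ← Finset.add_sum_erase _ (fun j => (S j).length) (Finset.mem_univ k),
      Finset.sum_congr rfl fun j hj => by
        rw [Function.update_of_ne (Finset.ne_of_mem_erase hj)], Function.update_self]
    omega
  induction h with
  | push => exact sum_length_update_le _ _ _ (by simp)
  | pop => exact sum_length_update_le _ _ _ (by simp only [List.length_tail]; omega)
  | _ => omega

end Run

/-- The Turing machine of a program, with input stack `k₀`, output stack `k₁` and initial memory
`v₀`. -/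
def machine [DecidableEq K] [Fintype K] [Fintype σ] (p : StackProg Γ σ) (k₀ k₁ : K) [Fintype (Γ k₀)]
    (v₀ : σ) : FinTM2 where
  K := K
  k₀ := k₀
  k₁ := k₁
  Γ := Γ
  Λ := Label p
  main := entry p
  σ := σ
  initialState := v₀
  m := stmtAt p id none

end StackProg

/-! ### Computing with trees on a stack -/

namespace TreeMachine

open StackProg Computability

/-- The work stacks of the tree machine: trees are kept on `main`, the others are auxiliary. -/
inductive Register
  | main | x | y | z
  deriving DecidableEq

instance : Fintype Register where
  elems := {.main, .x, .y, .z}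
  complete k := by cases k <;> decide

/-- The alphabets of the stacks of the tree machine; the stack `none` is the input stack. -/
abbrev Sym : Option Register → Type
  | none => Γ'
  | some _ => Bool

/-- The programs of the tree machine, whose memory holds the symbol read last. -/
abbrev Program : Type := StackProg Sym (Option Γ')

/-- The bit in memory. -/
def bit (v : Option Γ') : Bool := v == some (Γ'.bit true)

/-- A bit, or its absence, as a memory content. -/
def readBit (o : Option Bool) : Option Γ' := o.map Γ'.bit

@[simp] theorem bit_readBit_some (b : Bool) : bit (readBit (some b)) = b := by cases b <;> rfl

/-- Push a fixed bit. -/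
def push (k : Register) (b : Bool) : Program := .push (some k) fun _ => b

/-- Push the bit in memory. -/
def put (k : Register) : Program := .push (some k) bit

/-- Pop a bit into memory. -/
def pop (k : Register) : Program := .pop (some k) fun _ => readBit

/-- Do nothing. -/
def skip : Program := .load id

/-- Empty the memory. -/
def clear : Program := .load fun _ => none

/-- Stacks with the given contents. -/
@[simp]
def contents (i : List Γ') (a x y z : List Bool) : ∀ k, List (Sym k)
  | none => i
  | some .main => a
  | some .x => x
  | some .y => y
  | some .z => z

section Instructions

variable {i : List Γ'} {a x y z w : List Bool} {v : Option Γ'} {b : Bool}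

@[simp] theorem update_contents_none {j : List Γ'} :
    Function.update (contents i a x y z) none j = contents j a x y z := by
  funext k; rcases k with _ | _ | _ <;> rfl

@[simp] theorem update_contents_main :
    Function.update (contents i a x y z) (some .main) w = contents i w x y z := by
  funext k; rcases k with _ | _ | _ <;> rfl

@[simp] theorem update_contents_x :
    Function.update (contents i a x y z) (some .x) w = contents i a w y z := by
  funext k; rcases k with _ | _ | _ <;> rfl

@[simp] theorem update_contents_y :
    Function.update (contents i a x y z) (some .y) w = contents i a x w z := by
  funext k; rcases k with _ | _ | _ <;> rfl

@[simp] theorem update_contents_z :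
    Function.update (contents i a x y z) (some .z) w = contents i a x y w := by
  funext k; rcases k with _ | _ | _ <;> rfl

theorem sum_length_contents : ∑ k, (contents i a x y z k).length =
    i.length + (a.length + x.length + y.length + z.length) := by
  rw [Fintype.sum_option, show (Finset.univ : Finset Register) = {.main, .x, .y, .z} from rfl]
  simp [contents, add_assoc]

theorem run_push_main :
    Run (push .main b) v (contents i a x y z) 1 v (contents i (b :: a) x y z) := by
  simpa [push] using Run.push (k := some .main) (f := fun _ => b) (v := v) (S := contents i a x y z)

theorem run_push_z : Run (push .z b) v (contents i a x y z) 1 v (contents i a x y (b :: z)) := by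
  simpa [push] using Run.push (k := some .z) (f := fun _ => b) (v := v) (S := contents i a x y z)

theorem run_put_main :
    Run (put .main) v (contents i a x y z) 1 v (contents i (bit v :: a) x y z) := by
  simpa [put] using Run.push (k := some .main) (f := bit) (v := v) (S := contents i a x y z)

theorem run_put_x : Run (put .x) v (contents i a x y z) 1 v (contents i a (bit v :: x) y z) := by
  simpa [put] using Run.push (k := some .x) (f := bit) (v := v) (S := contents i a x y z)

theorem run_put_y : Run (put .y) v (contents i a x y z) 1 v (contents i a x (bit v :: y) z) := by
  simpa [put] using Run.push (k := some .y) (f := bit) (v := v) (S := contents i a x y z)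

theorem run_pop_main :
    Run (pop .main) v (contents i a x y z) 1 (readBit a.head?) (contents i a.tail x y z) := by
  simpa [pop] using Run.pop (k := some .main) (f := fun _ => readBit) (v := v)
    (S := contents i a x y z)

theorem run_pop_x :
    Run (pop .x) v (contents i a x y z) 1 (readBit x.head?) (contents i a x.tail y z) := by
  simpa [pop] using Run.pop (k := some .x) (f := fun _ => readBit) (v := v)
    (S := contents i a x y z)

theorem run_pop_y :
    Run (pop .y) v (contents i a x y z) 1 (readBit y.head?) (contents i a x y.tail z) := by
  simpa [pop] using Run.pop (k := some .y) (f := fun _ => readBit) (v := v)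
    (S := contents i a x y z)

theorem run_pop_z :
    Run (pop .z) v (contents i a x y z) 1 (readBit z.head?) (contents i a x y z.tail) := by
  simpa [pop] using Run.pop (k := some .z) (f := fun _ => readBit) (v := v)
    (S := contents i a x y z)

theorem run_skip {S : ∀ k, List (Sym k)} : Run skip v S 1 v S := .load

theorem run_clear {S : ∀ k, List (Sym k)} : Run clear v S 1 none S := .load

end Instructions

/-- The prefix code of a binary tree, `true` marking the inner nodes. -/
def prefixCode : BinaryTree Unit → List Bool
  | .nil => [false]
  | .node _ l r => true :: (prefixCode l ++ prefixCode r)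

/-- `IsSink put F`: the program `put` adds the bit in memory to the list `l` that is stored on the
stacks `x` and `y` as `F l`. -/
def IsSink (put : Program) (F : List Bool → List Bool × List Bool) : Prop :=
  ∀ v a l z, Run put v (contents [] a (F l).1 (F l).2 z) 2 v
    (contents [] a (F (bit v :: l)).1 (F (bit v :: l)).2 z)

/-- `IsSource get F`: the program `get` removes the first bit of the list `l` that is stored on the
stacks `x` and `y` as `F l`, and reads it into memory. -/
def IsSource (get : Program) (F : List Bool → List Bool × List Bool) : Prop :=
  ∀ v a l, Run get v (contents [] a (F l).1 (F l).2 []) 1 (readBit l.head?)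
    (contents [] a (F l.tail).1 (F l.tail).2 [])

theorem isSink_skip : IsSink skip fun _ => ([], []) :=
  fun _ _ _ _ => run_skip.mono one_le_two

theorem isSink_put_x (y : List Bool) : IsSink (put .x) fun l => (l, y) :=
  fun _ _ _ _ => run_put_x.mono one_le_two

theorem isSink_put_y (x : List Bool) : IsSink (put .y) fun l => (x, l) :=
  fun _ _ _ _ => run_put_y.mono one_le_two

theorem isSink_put_x_put_y : IsSink (.seq (put .x) (put .y)) fun l => (l, l) :=
  fun _ _ _ _ => run_put_x.seq run_put_y

theorem isSource_pop_x (y : List Bool) : IsSource (pop .x) fun l => (l, y) :=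
  fun _ _ _ => run_pop_x

theorem isSource_pop_y (x : List Bool) : IsSource (pop .y) fun l => (x, l) :=
  fun _ _ _ => run_pop_y

/-- Move one symbol of the top tree of the main stack to `put`, and read into memory whether
symbols remain: the length of the stack `z` is the number of subtrees to come after the current
one. -/
def moveSymbol (put : Program) : Program :=
  .seq (pop .main) (.seq put
    (.seq (.ite bit (.seq (push .z true) (push .z true)) skip) (pop .z)))

/-- Remove the top tree from the main stack, feeding its symbols to `put` one by one. -/
def moveTree (put : Program) : Program :=
  .seq (.load fun _ => readBit (some true)) (.loop Option.isSome (moveSymbol put))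

section MoveTree

variable {put : Program} {F : List Bool → List Bool × List Bool} (hput : IsSink put F)
include hput

theorem run_moveSymbol_false (v : Option Γ') (a l z : List Bool) :
    Run (moveSymbol put) v (contents [] (false :: a) (F l).1 (F l).2 z) 6 (readBit z.head?)
      (contents [] a (F (false :: l)).1 (F (false :: l)).2 z.tail) :=
  run_pop_main.seq ((hput _ _ _ _).seq ((Run.ite_false rfl run_skip).seq run_pop_z))

theorem run_moveSymbol_true (v : Option Γ') (a l z : List Bool) :
    Run (moveSymbol put) v (contents [] (true :: a) (F l).1 (F l).2 z) 7 (readBit (some true))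
      (contents [] a (F (true :: l)).1 (F (true :: l)).2 (true :: z)) :=
  run_pop_main.seq ((hput _ _ _ _).seq
    ((Run.ite_true rfl (run_push_z.seq run_push_z)).seq run_pop_z))

theorem run_loop_moveSymbol (t : BinaryTree Unit) {w l z : List Bool} {T : ℕ} {v' : Option Γ'}
    {S' : ∀ k, List (Sym k)}
    (h : Run (.loop Option.isSome (moveSymbol put)) (readBit z.head?)
      (contents [] w (F ((prefixCode t).reverse ++ l)).1 (F ((prefixCode t).reverse ++ l)).2 z.tail)
      T v' S') :
    Run (.loop Option.isSome (moveSymbol put)) (readBit (some true))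
      (contents [] (prefixCode t ++ w) (F l).1 (F l).2 z) (8 * (prefixCode t).length + T) v'
        S' := by
  induction t generalizing w l z T with
  | nil =>
    refine (Run.loop_step rfl (run_moveSymbol_false hput _ w l z) h).mono ?_
    simp only [prefixCode, List.length_singleton]
    omega
  | node _ a b iha ihb =>
    have hb := ihb (l := (prefixCode a).reverse ++ true :: l) (by simpa [prefixCode] using h)
    have ha := iha (w := prefixCode b ++ w) (l := true :: l) (z := true :: z) hb
    rw [← List.append_assoc] at ha
    refine (Run.loop_step rfl (run_moveSymbol_true hput _ _ l z) ha).mono ?_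
    simp only [prefixCode, List.length_cons, List.length_append]
    omega

theorem run_moveTree (t : BinaryTree Unit) (v : Option Γ') (w l : List Bool) :
    Run (moveTree put) v (contents [] (prefixCode t ++ w) (F l).1 (F l).2 [])
      (2 + 8 * (prefixCode t).length) none
      (contents [] w (F ((prefixCode t).reverse ++ l)).1 (F ((prefixCode t).reverse ++ l)).2 []) :=
  (Run.load.seq (run_loop_moveSymbol hput t (.loop_done rfl))).mono (by omega)

end MoveTree

/-- Push the bits that `get` provides onto the main stack. -/
def moveBack (get : Program) : Program := .seq get (.loop Option.isSome (.seq (put .main) get))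

theorem run_moveBack {get : Program} {F : List Bool → List Bool × List Bool}
    (hget : IsSource get F) (v : Option Γ') (w l : List Bool) :
    Run (moveBack get) v (contents [] w (F l).1 (F l).2 []) (2 + 3 * l.length) none
      (contents [] (l.reverse ++ w) (F []).1 (F []).2 []) := by
  have run_loop (l w : List Bool) : Run (.loop Option.isSome (.seq (put .main) get))
      (readBit l.head?) (contents [] w (F l.tail).1 (F l.tail).2 []) (1 + 3 * l.length) none
      (contents [] (l.reverse ++ w) (F []).1 (F []).2 []) := by
    induction l generalizing w with
    | nil => exact .loop_done rfl
    | cons b l ih =>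
      rw [List.reverse_cons, List.append_assoc]
      refine (Run.loop_step rfl (run_put_main.seq (hget _ _ _)) (S₂ := _) (v₂ := none) ?_).mono
        (t := 1 + 1 + (1 + 3 * l.length) + 1) (by rw [List.length_cons]; omega)
      simpa using ih (b :: w)
  exact ((hget _ _ _).seq (run_loop l w)).mono (by omega)

/-- `Exec p a T a'`: with empty memory and all other stacks empty before and after, the program `p`
changes the main stack from `a` to `a'` within `T` steps. -/
abbrev Exec (p : Program) (a : List Bool) (T : ℕ) (a' : List Bool) : Prop :=
  Run p none (contents [] a [] [] []) T none (contents [] a' [] [] [])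

theorem Exec.length_le {p : Program} {a a' : List Bool} {T : ℕ} (h : Exec p a T a') :
    a'.length ≤ a.length + T := by
  simpa only [sum_length_contents, List.length_nil, zero_add, add_zero] using h.sum_length_le

/-- Remove the top symbol. -/
def uncons : Program := .seq (pop .main) clear

theorem exec_uncons {b : Bool} {a : List Bool} : Exec uncons (b :: a) 2 a :=
  run_pop_main.seq run_clear

/-- Remove the top symbol and branch on it. -/
def ifTop (p q : Program) : Program :=
  .seq (pop .main) (.ite bit (.seq clear p) (.seq clear q))

theorem exec_ifTop_true {p q : Program} {a a' : List Bool} {T : ℕ} (h : Exec p a T a') :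
    Exec (ifTop p q) (true :: a) (T + 3) a' :=
  (run_pop_main.seq (Run.ite_true rfl (run_clear.seq h))).mono (by omega)

theorem exec_ifTop_false {p q : Program} {a a' : List Bool} {T : ℕ} (h : Exec q a T a') :
    Exec (ifTop p q) (false :: a) (T + 3) a' :=
  (run_pop_main.seq (Run.ite_false rfl (run_clear.seq h))).mono (by omega)

/-- Remove the top tree. -/
def drop : Program := moveTree skip

theorem exec_drop (t : BinaryTree Unit) (w : List Bool) :
    Exec drop (prefixCode t ++ w) (2 + 8 * (prefixCode t).length) w :=
  run_moveTree isSink_skip t none w []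

/-- Duplicate the top tree. -/
def dup : Program :=
  .seq (moveTree (.seq (put .x) (put .y))) (.seq (moveBack (pop .x)) (moveBack (pop .y)))

theorem exec_dup (t : BinaryTree Unit) (w : List Bool) :
    Exec dup (prefixCode t ++ w) (6 + 14 * (prefixCode t).length)
      (prefixCode t ++ (prefixCode t ++ w)) := by
  have h₁ := run_moveTree isSink_put_x_put_y t none w []
  have h₂ := run_moveBack (isSource_pop_x (prefixCode t).reverse) none w (prefixCode t).reverse
  have h₃ := run_moveBack (isSource_pop_y []) none (prefixCode t ++ w) (prefixCode t).reverse
  simp only [List.append_nil, List.reverse_reverse, List.length_reverse] at h₁ h₂ h₃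
  exact (h₁.seq (h₂.seq h₃)).mono (by omega)

/-- Exchange the two top trees. -/
def swap : Program :=
  .seq (moveTree (put .x)) (.seq (moveTree (put .y)) (.seq (moveBack (pop .x)) (moveBack (pop .y))))

theorem exec_swap (s t : BinaryTree Unit) (w : List Bool) :
    Exec swap (prefixCode s ++ (prefixCode t ++ w))
      (8 + 11 * (prefixCode s).length + 11 * (prefixCode t).length)
      (prefixCode t ++ (prefixCode s ++ w)) := by
  have h₁ := run_moveTree (isSink_put_x []) s none (prefixCode t ++ w) []
  have h₂ := run_moveTree (isSink_put_y (prefixCode s).reverse) t none w []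
  have h₃ := run_moveBack (isSource_pop_x (prefixCode t).reverse) none w (prefixCode s).reverse
  have h₄ := run_moveBack (isSource_pop_y []) none (prefixCode s ++ w) (prefixCode t).reverse
  simp only [List.append_nil, List.reverse_reverse, List.length_reverse] at h₁ h₂ h₃ h₄
  exact (h₁.seq (h₂.seq (h₃.seq h₄))).mono (by omega)

/-- Pair the first and the third tree, and move the second one below the pair. -/
def pairUnder : Program :=
  .seq swap (.seq (moveTree (put .y)) (.seq (push .main true) (.seq (moveTree (put .x))
    (.seq (moveBack (pop .y)) (moveBack (pop .x))))))

theorem exec_pairUnder (s t u : BinaryTree Unit) (w : List Bool) :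
    Exec pairUnder (prefixCode s ++ (prefixCode t ++ (prefixCode u ++ w)))
      (28 + 22 * (prefixCode s).length + 22 * (prefixCode t).length + 22 * (prefixCode u).length)
      (prefixCode (.node () s u) ++ (prefixCode t ++ w)) := by
  set su : BinaryTree Unit := .node () s u with hsu
  have h₁ := run_moveTree (isSink_put_y []) t none (prefixCode s ++ (prefixCode u ++ w)) []
  have h₂ : Run (push .main true) none
      (contents [] (prefixCode s ++ (prefixCode u ++ w)) [] (prefixCode t).reverse []) 1 none
      (contents [] (prefixCode su ++ w) [] (prefixCode t).reverse []) := by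
    simpa only [hsu, prefixCode, List.cons_append, List.append_assoc] using run_push_main
  have h₃ := run_moveTree (isSink_put_x (prefixCode t).reverse) su none w []
  have h₄ := run_moveBack (isSource_pop_y (prefixCode su).reverse) none w (prefixCode t).reverse
  have h₅ := run_moveBack (isSource_pop_x []) none (prefixCode t ++ w) (prefixCode su).reverse
  simp only [List.append_nil, List.reverse_reverse, List.length_reverse] at h₁ h₂ h₃ h₄ h₅
  refine ((exec_swap s t _).seq (h₁.seq (h₂.seq (h₃.seq (h₄.seq h₅))))).mono ?_
  simp only [hsu, prefixCode, List.length_cons, List.length_append]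
  omega

theorem polynomial_eval_monotone (P : Polynomial ℕ) : Monotone fun n => P.eval n := by
  intro a b hab
  induction P using Polynomial.induction_on' with
  | add p q hp hq => simpa using Nat.add_le_add hp hq
  | monomial n c => simpa using Nat.mul_le_mul_left c (Nat.pow_le_pow_left hab n)

/-- A representation of the elements of a type by the trees on which the tree machine works. -/
class TreeEncodable (α : Type*) where
  toTree : α → BinaryTree Unit

/-- The code of an element on the main stack. -/
def bits {α : Type*} [TreeEncodable α] (a : α) : List Bool := prefixCode (TreeEncodable.toTree a)

/-- The length of the code of an element. -/
def size {α : Type*} [TreeEncodable α] (a : α) : ℕ := (bits a).length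

instance : TreeEncodable Unit := ⟨fun _ => .nil⟩

instance : TreeEncodable Bool := ⟨fun b => if b then .node () .nil .nil else .nil⟩

/-- Natural numbers are represented in unary. -/
instance : TreeEncodable ℕ := ⟨Nat.rec .nil fun _ t => .node () .nil t⟩

instance {α β : Type*} [TreeEncodable α] [TreeEncodable β] : TreeEncodable (α × β) :=
  ⟨fun x => .node () (TreeEncodable.toTree x.1) (TreeEncodable.toTree x.2)⟩

instance {α : Type*} [TreeEncodable α] : TreeEncodable (List α) :=
  ⟨List.foldr (fun a t => .node () (TreeEncodable.toTree a) t) .nil⟩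

/-- The number that represents a symbol of the input alphabet. -/
def symbolIndex : Γ' → ℕ
  | .bit false => 0
  | .bit true => 1
  | .bra => 2
  | .ket => 3
  | .comma => 4
  | .blank => 5

theorem symbolIndex_injective : Function.Injective symbolIndex := by decide

instance : TreeEncodable Γ' := ⟨fun g => TreeEncodable.toTree (symbolIndex g)⟩

section Size

variable {α β : Type*} [TreeEncodable α] [TreeEncodable β]

@[simp] theorem bits_true : bits true = [true, false, false] := rfl

@[simp] theorem bits_false : bits false = [false] := rfl

@[simp] theorem bits_succ (n : ℕ) : bits (n + 1) = true :: false :: bits n := rfl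

@[simp] theorem bits_mk (a : α) (b : β) : bits (a, b) = true :: (bits a ++ bits b) := rfl

@[simp] theorem bits_cons (a : α) (l : List α) : bits (a :: l) = true :: (bits a ++ bits l) := rfl

theorem size_bool_le (b : Bool) : size b ≤ 3 := by cases b <;> simp [size]

@[simp] theorem size_nat (n : ℕ) : size n = 2 * n + 1 := by
  induction n with
  | zero => rfl
  | succ n ih => simp only [size, bits_succ, List.length_cons] at ih ⊢; omega

theorem size_symbol_le (g : Γ') : size g ≤ 11 := by
  change size (symbolIndex g) ≤ 11
  have : ∀ g, symbolIndex g ≤ 5 := by decide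
  rw [size_nat]
  linarith [this g]

@[simp] theorem size_mk (a : α) (b : β) : size (a, b) = size a + size b + 1 := by simp [size]

@[simp] theorem size_nil : size ([] : List α) = 1 := rfl

@[simp] theorem size_cons (a : α) (l : List α) : size (a :: l) = size a + size l + 1 := by
  simp [size]

theorem size_list (l : List α) : size l = (l.map size).sum + l.length + 1 := by
  induction l with
  | nil => rfl
  | cons a l ih => simp only [size_cons, List.map_cons, List.sum_cons, List.length_cons, ih]; omega

theorem length_le_size (l : List α) : l.length ≤ size l := by
  rw [size_list]; omega

theorem size_le_of_mem {a : α} {l : List α} (h : a ∈ l) : size a ≤ size l := by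
  have := List.le_sum_of_mem (List.mem_map_of_mem (f := size) h)
  rw [size_list]; omega

theorem size_append (l l' : List α) : size (l ++ l') + 1 = size l + size l' := by
  simp only [size_list, List.map_append, List.sum_append, List.length_append]; omega

theorem size_le_of_sublist {l l' : List α} (h : l.Sublist l') : size l ≤ size l' := by
  have := (h.map size).sum_le_sum fun _ _ => Nat.zero_le _
  have := h.length_le
  simp only [size_list]; omega

theorem size_reverse (l : List α) : size l.reverse = size l := by
  simp only [size_list, List.map_reverse, List.sum_reverse, List.length_reverse]

theorem size_list_le {l : List α} {M : ℕ} (h : ∀ a ∈ l, size a ≤ M) :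
    size l ≤ l.length * (M + 1) + 1 := by
  have := List.sum_le_card_nsmul (l.map size) M (by simpa using h)
  rw [List.length_map, smul_eq_mul] at this
  rw [size_list, Nat.mul_succ]
  omega

end Size

/-! ### Polynomial-time functions on trees -/

/-- The function `f` is computed by a program in time polynomial in the size of its argument. -/
@[fun_prop]
def IsPolyTime {α β : Type*} [TreeEncodable α] [TreeEncodable β] (f : α → β) : Prop :=
  ∃ (p : Program) (P : Polynomial ℕ), ∀ (a : α) (w : List Bool),
    Exec p (bits a ++ w) (P.eval (size a)) (bits (f a) ++ w)

section Exec

variable {α β γ : Type*} [TreeEncodable α] [TreeEncodable β] [TreeEncodable γ]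

theorem exec_drop_bits (a : α) (w : List Bool) : Exec drop (bits a ++ w) (2 + 8 * size a) w :=
  exec_drop _ _

theorem exec_dup_bits (a : α) (w : List Bool) :
    Exec dup (bits a ++ w) (6 + 14 * size a) (bits a ++ (bits a ++ w)) :=
  exec_dup _ _

theorem exec_swap_bits (a : α) (b : β) (w : List Bool) :
    Exec swap (bits a ++ (bits b ++ w)) (8 + 11 * size a + 11 * size b)
      (bits b ++ (bits a ++ w)) :=
  exec_swap _ _ _

theorem exec_pairUnder_bits (a : α) (b : β) (c : γ) (w : List Bool) :
    Exec pairUnder (bits a ++ (bits b ++ (bits c ++ w)))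
      (28 + 22 * size a + 22 * size b + 22 * size c) (bits (a, c) ++ (bits b ++ w)) :=
  exec_pairUnder _ _ _ _

theorem exec_pair_bits (a : α) (b : β) (w : List Bool) :
    Exec (push .main true) (bits a ++ (bits b ++ w)) 1 (bits (a, b) ++ w) := by
  rw [← List.append_assoc]
  exact run_push_main

theorem exec_unpair_bits (a : α × β) (w : List Bool) :
    Exec uncons (bits a ++ w) 2 (bits a.1 ++ (bits a.2 ++ w)) := by
  rw [← List.append_assoc]
  exact exec_uncons (a := bits a.1 ++ bits a.2 ++ w)

theorem run_pop_bits (l : List α) (w : List Bool) :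
    Run (pop .main) none (contents [] (bits l ++ w) [] [] []) 1 (readBit (bits l).head?)
      (contents [] ((bits l).tail ++ w) [] [] []) := by
  cases l <;> exact run_pop_main

/-- Push a fixed word. -/
def pushWord : List Bool → Program
  | [] => skip
  | b :: l => .seq (pushWord l) (push .main b)

theorem run_pushWord (l : List Bool) {i : List Γ'} {a x y z : List Bool} {v : Option Γ'} :
    Run (pushWord l) v (contents i a x y z) (1 + l.length) v (contents i (l ++ a) x y z) := by
  induction l with
  | nil => exact run_skip
  | cons b l ih => exact (ih.seq run_push_main).mono (by rw [List.length_cons]; omega)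

end Exec

namespace IsPolyTime

open Polynomial (eval_add eval_mul eval_X eval_comp eval_ofNat eval_one)

variable {α β γ σ : Type*} [TreeEncodable α] [TreeEncodable β] [TreeEncodable γ] [TreeEncodable σ]

theorem of_bits_eq {f : α → β} (h : ∀ a, bits (f a) = bits a) : IsPolyTime f :=
  ⟨skip, 1, fun a w => by simpa [h] using run_skip⟩

theorem exists_size_le {f : α → β} (hf : IsPolyTime f) :
    ∃ Q : Polynomial ℕ, ∀ a, size (f a) ≤ Q.eval (size a) := by
  obtain ⟨p, P, h⟩ := hf
  refine ⟨.X + P, fun a => ?_⟩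
  simpa [size] using (h a []).length_le

@[fun_prop]
theorem id : IsPolyTime fun a : α => a := of_bits_eq fun _ => rfl

@[fun_prop]
theorem const (b : β) : IsPolyTime fun _ : α => b := by
  refine ⟨.seq drop (pushWord (bits b)), 2 + 8 * .X + (1 + .C (size b)), fun a w => ?_⟩
  refine ((exec_drop_bits a w).seq (run_pushWord _)).mono ?_
  simp [size]

@[fun_prop]
theorem comp {g : β → γ} {f : α → β} (hg : IsPolyTime g) (hf : IsPolyTime f) :
    IsPolyTime fun a => g (f a) := by
  obtain ⟨Q, hQ⟩ := hf.exists_size_le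
  obtain ⟨p, P, hp⟩ := hf
  obtain ⟨q, R, hq⟩ := hg
  refine ⟨.seq p q, P + R.comp Q, fun a w => ((hp a w).seq (hq (f a) w)).mono ?_⟩
  simpa using polynomial_eval_monotone R (hQ a)

@[fun_prop]
theorem pair {f : α → β} {g : α → γ} (hf : IsPolyTime f) (hg : IsPolyTime g) :
    IsPolyTime fun a => (f a, g a) := by
  obtain ⟨Q, hQ⟩ := hg.exists_size_le
  obtain ⟨p, P, hp⟩ := hf
  obtain ⟨q, R, hq⟩ := hg
  refine ⟨.seq dup (.seq q (.seq swap (.seq p (push .main true)))),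
    6 + 14 * .X + R + (8 + 11 * Q + 11 * .X) + P + 1, fun a w => ?_⟩
  refine ((exec_dup_bits a w).seq ((hq a _).seq ((exec_swap_bits (g a) a w).seq
    ((hp a _).seq (exec_pair_bits (f a) (g a) w))))).mono ?_
  have := hQ a
  simp only [eval_add, eval_mul, eval_X, eval_ofNat, eval_one]
  omega

theorem comp₂ {f : β → γ → σ} {u : α → β} {v : α → γ}
    (hf : IsPolyTime fun x : β × γ => f x.1 x.2) (hu : IsPolyTime u) (hv : IsPolyTime v) :
    IsPolyTime fun a => f (u a) (v a) :=
  hf.comp (hu.pair hv)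

@[fun_prop]
theorem fst {f : α → β × γ} (hf : IsPolyTime f) : IsPolyTime fun a => (f a).1 := by
  refine comp (g := Prod.fst) ⟨.seq uncons (.seq swap drop), 12 + 20 * .X, fun a w => ?_⟩ hf
  refine ((exec_unpair_bits a w).seq ((exec_swap_bits a.1 a.2 w).seq
    (exec_drop_bits a.2 _))).mono ?_
  rw [show size a = _ from size_mk a.1 a.2]
  simp only [eval_add, eval_mul, eval_X, eval_ofNat]
  omega

@[fun_prop]
theorem snd {f : α → β × γ} (hf : IsPolyTime f) : IsPolyTime fun a => (f a).2 := by
  refine comp (g := Prod.snd) ⟨.seq uncons drop, 12 + 20 * .X, fun a w => ?_⟩ hf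
  refine ((exec_unpair_bits a w).seq (exec_drop_bits a.1 _)).mono ?_
  rw [show size a = _ from size_mk a.1 a.2]
  simp only [eval_add, eval_mul, eval_X, eval_ofNat]
  omega

theorem bool_ite {c : α → Bool} {f g : α → β} (hc : IsPolyTime c) (hf : IsPolyTime f)
    (hg : IsPolyTime g) : IsPolyTime fun a => if c a = true then f a else g a := by
  obtain ⟨q, R, hq⟩ := hc
  obtain ⟨p₁, P₁, hp₁⟩ := hf
  obtain ⟨p₂, P₂, hp₂⟩ := hg
  refine ⟨.seq dup (.seq q (ifTop (.seq uncons (.seq uncons p₁)) p₂)),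
    6 + 14 * .X + R + (P₁ + P₂ + 10), fun a w => ?_⟩
  have hdup := exec_dup_bits a w
  have htest := hq a (bits a ++ w)
  simp only [eval_add, eval_mul, eval_X, eval_ofNat]
  rcases h : c a with _ | _ <;> rw [h] at htest
  · exact (hdup.seq (htest.seq (exec_ifTop_false (hp₂ a w)))).mono (by omega)
  · exact (hdup.seq (htest.seq (exec_ifTop_true
      (exec_uncons.seq (exec_uncons.seq (hp₁ a w)))))).mono (by omega)

@[fun_prop]
theorem cons {f : α → β} {g : α → List β} (hf : IsPolyTime f) (hg : IsPolyTime g) :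
    IsPolyTime fun a => f a :: g a :=
  comp (g := fun x : β × List β => x.1 :: x.2) (of_bits_eq fun _ => rfl) (hf.pair hg)

@[fun_prop]
theorem succ {f : α → ℕ} (hf : IsPolyTime f) : IsPolyTime fun a => f a + 1 :=
  comp (g := fun x : Unit × ℕ => x.2 + 1) (of_bits_eq fun _ => rfl) ((const ()).pair hf)

@[fun_prop]
theorem replicate_unit {f : α → ℕ} (hf : IsPolyTime f) :
    IsPolyTime fun a => List.replicate (f a) () := by
  refine comp (g := fun n => List.replicate n ()) (of_bits_eq fun n => ?_) hf
  induction n with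
  | zero => rfl
  | succ n ih => rw [List.replicate_succ, bits_cons, ih]; rfl

theorem list_cases {l : α → List β} {f : α → γ} {g : α → β → List β → γ} (hl : IsPolyTime l)
    (hf : IsPolyTime f) (hg : IsPolyTime fun x : α × β × List β => g x.1 x.2.1 x.2.2) :
    IsPolyTime fun a => (match l a with
      | [] => f a
      | b :: t => g a b t : γ) := by
  obtain ⟨Q, hQ⟩ := hl.exists_size_le
  obtain ⟨q, R, hq⟩ := hl
  obtain ⟨p₁, P₁, hp₁⟩ := hf
  obtain ⟨p₂, P₂, hp₂⟩ := hg
  refine ⟨.seq dup (.seq q (ifTop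
      (.seq (push .main true) (.seq swap (.seq (push .main true) p₂))) p₁)),
    6 + 14 * .X + R + (P₁ + 3) + (15 + 11 * .X + 11 * Q + P₂.comp (.X + Q + 1)), fun a w => ?_⟩
  have hdup := exec_dup_bits a w
  have htest := hq a (bits a ++ w)
  have hsize := hQ a
  simp only [eval_add, eval_mul, eval_X, eval_comp, eval_ofNat, eval_one]
  rcases h : l a with _ | ⟨b, t⟩ <;> rw [h] at htest hsize
  · exact (hdup.seq (htest.seq (exec_ifTop_false (hp₁ a w)))).mono (by omega)
  · rw [bits_cons, List.cons_append, List.append_assoc] at htest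
    refine (hdup.seq (htest.seq (exec_ifTop_true ((exec_pair_bits b t _).seq
      ((exec_swap_bits (b, t) a w).seq
        ((exec_pair_bits a (b, t) w).seq (hp₂ (a, b, t) w))))))).mono ?_
    rw [size_cons] at hsize
    have hP₂ := polynomial_eval_monotone P₂
      (show size (a, b, t) ≤ size a + Q.eval (size a) + 1 by simp only [size_mk]; omega)
    simp only [size_mk] at hP₂ ⊢
    omega

end IsPolyTime

/-- The body of the loop of `foldProgram`. -/
def foldStep (p : Program) : Program :=
  .seq clear (.seq pairUnder (.seq p (.seq swap (pop .main))))

/-- Given a program for a step `(b, s) ↦ s'`, fold over the list on top of the main stack, the state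
being the tree below it. -/
def foldProgram (p : Program) : Program :=
  .seq (pop .main) (.seq (.loop bit (foldStep p)) clear)

section Fold

variable {β σ : Type*} [TreeEncodable β] [TreeEncodable σ] {f : β × σ → σ} {p : Program}
  {P : Polynomial ℕ} {N M : ℕ}

theorem run_foldStep (hp : ∀ a w, Exec p (bits a ++ w) (P.eval (size a)) (bits (f a) ++ w))
    {b : β} {l : List β} {s : σ} (w : List Bool) (hN : size (b :: l) ≤ N) (hs : size s ≤ M)
    (hs' : size (f (b, s)) ≤ M) :
    Run (foldStep p) (readBit (some true))
      (contents [] (bits b ++ (bits l ++ (bits s ++ w))) [] [] [])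
      (38 + 33 * N + 33 * M + P.eval (N + M + 1)) (readBit (bits l).head?)
      (contents [] ((bits l).tail ++ (bits (f (b, s)) ++ w)) [] [] []) := by
  refine (run_clear.seq ((exec_pairUnder_bits b l s w).seq ((hp (b, s) _).seq
    ((exec_swap_bits (f (b, s)) l w).seq (run_pop_bits l _))))).mono ?_
  rw [size_cons] at hN
  have := polynomial_eval_monotone P (show size (b, s) ≤ N + M + 1 by rw [size_mk]; omega)
  simp only at this
  omega

theorem run_loop_foldStep
    (hp : ∀ a w, Exec p (bits a ++ w) (P.eval (size a)) (bits (f a) ++ w)) (w : List Bool) :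
    ∀ (l : List β) (s : σ), size l ≤ N →
      (∀ l', l' <+: l → size (l'.foldl (fun s b => f (b, s)) s) ≤ M) →
      Run (.loop bit (foldStep p)) (readBit (bits l).head?)
        (contents [] ((bits l).tail ++ (bits s ++ w)) [] [] [])
        (1 + (39 + 33 * N + 33 * M + P.eval (N + M + 1)) * l.length) (readBit (some false))
        (contents [] (bits (l.foldl (fun s b => f (b, s)) s) ++ w) [] [] [])
  | [], _, _, _ => .loop_done rfl
  | b :: l, s, hN, hM => by
    have hstep := run_foldStep hp w hN (hM [] List.nil_prefix) (hM [b] (by simp))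
    have hloop := run_loop_foldStep hp w l (f (b, s)) (by rw [size_cons] at hN; omega)
      fun l' hl' => hM (b :: l') (by simpa using hl')
    rw [bits_cons, List.tail_cons, List.append_assoc, List.length_cons, Nat.mul_succ]
    exact (Run.loop_step rfl hstep hloop).mono (by omega)

theorem exec_foldProgram
    (hp : ∀ a w, Exec p (bits a ++ w) (P.eval (size a)) (bits (f a) ++ w))
    {l : List β} {s : σ} (w : List Bool) (hN : size l ≤ N)
    (hM : ∀ l', l' <+: l → size (l'.foldl (fun s b => f (b, s)) s) ≤ M) :
    Exec (foldProgram p) (bits l ++ (bits s ++ w))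
      (3 + (39 + 33 * N + 33 * M + P.eval (N + M + 1)) * N)
      (bits (l.foldl (fun s b => f (b, s)) s) ++ w) := by
  refine ((run_pop_bits l _).seq ((run_loop_foldStep hp w l s hN hM).seq run_clear)).mono ?_
  have := Nat.mul_le_mul_left (39 + 33 * N + 33 * M + P.eval (N + M + 1))
    ((length_le_size l).trans hN)
  omega

end Fold

theorem size_foldr_le {β σ : Type*} [TreeEncodable σ] {f : β → σ → σ} {l : List β} {s : σ}
    {D : ℕ} (hf : ∀ b ∈ l, ∀ s, size (f b s) ≤ size s + D) :
    size (l.foldr f s) ≤ size s + l.length * D := by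
  induction l with
  | nil => simp
  | cons b l ih =>
    have hstep := hf b List.mem_cons_self (l.foldr f s)
    have := ih fun c hc => hf c (List.mem_cons_of_mem _ hc)
    rw [List.foldr_cons, List.length_cons, Nat.succ_mul]
    omega

namespace IsPolyTime

open Polynomial (eval_add eval_mul eval_X eval_comp eval_ofNat eval_one)

variable {α β γ σ : Type*} [TreeEncodable α] [TreeEncodable β] [TreeEncodable γ] [TreeEncodable σ]

theorem foldl {h : α → List β} {g : α → σ} {f : α → β → σ → σ} (hh : IsPolyTime h)
    (hg : IsPolyTime g) (hf : IsPolyTime fun x : α × β × σ => f x.1 x.2.1 x.2.2)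
    (Q : Polynomial ℕ)
    (hQ : ∀ a l, l <+: h a → size (l.foldl (fun s b => f a b s) (g a)) ≤ Q.eval (size a)) :
    IsPolyTime fun a => (h a).foldl (fun s b => f a b s) (g a) := by
  obtain ⟨p, P, hp⟩ : IsPolyTime fun x : β × α × σ => (x.2.1, f x.2.1 x.1 x.2.2) :=
    .pair (by fun_prop) (hf.comp (f := fun x : β × α × σ => (x.2.1, x.1, x.2.2)) (by fun_prop))
  obtain ⟨R, hR⟩ := hh.exists_size_le
  obtain ⟨q, P₁, hq⟩ : IsPolyTime fun a => (h a, (a, g a)) := by fun_prop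
  have foldl_keep (a : α) (l : List β) (s : σ) :
      l.foldl (fun x b => (x.1, f x.1 b x.2)) (a, s) = (a, l.foldl (fun s b => f a b s) s) := by
    induction l generalizing s with
    | nil => rfl
    | cons b l ih => exact ih _
  suffices IsPolyTime fun a => (a, (h a).foldl (fun s b => f a b s) (g a)) from this.snd
  refine ⟨.seq q (.seq uncons (foldProgram p)), P₁ + (2 +
    (3 + (39 + 33 * R + 33 * (.X + Q + 1) + P.comp (R + (.X + Q + 1) + 1)) * R)), fun a w => ?_⟩
  have hfold := exec_foldProgram (M := size a + Q.eval (size a) + 1) hp (s := (a, g a)) w (hR a)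
    fun l hl => by
      have := hQ a l hl
      simp only [foldl_keep, size_mk]
      omega
  simp only [foldl_keep] at hfold
  refine ((hq a w).seq ((exec_unpair_bits _ w).seq hfold)).mono (Eq.le ?_)
  simp only [eval_add, eval_mul, eval_X, eval_comp, eval_ofNat, eval_one]

@[fun_prop]
theorem reverse {h : α → List β} (hh : IsPolyTime h) : IsPolyTime fun a => (h a).reverse := by
  obtain ⟨Q, hQ⟩ := hh.exists_size_le
  have foldl_cons_eq_reverse (l : List β) : l.foldl (fun s b => b :: s) [] = l.reverse := by simp
  simp only [← foldl_cons_eq_reverse]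
  refine foldl (f := fun _ b s => b :: s) hh (const []) (by fun_prop) Q fun a l hl => ?_
  rw [foldl_cons_eq_reverse, size_reverse]
  exact (size_le_of_sublist hl.sublist).trans (hQ a)

theorem foldr {h : α → List β} {g : α → σ} {f : α → β → σ → σ} (hh : IsPolyTime h)
    (hg : IsPolyTime g) (hf : IsPolyTime fun x : α × β × σ => f x.1 x.2.1 x.2.2)
    (Q : Polynomial ℕ)
    (hQ : ∀ a l, l <:+ h a → size (l.foldr (f a) (g a)) ≤ Q.eval (size a)) :
    IsPolyTime fun a => (h a).foldr (f a) (g a) := by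
  have (a : α) : (h a).foldr (f a) (g a) = (h a).reverse.foldl (fun s b => f a b s) (g a) := by
    rw [List.foldl_reverse]
  simp only [this]
  refine foldl hh.reverse hg hf Q fun a l hl => ?_
  rw [← List.reverse_reverse l, List.foldl_reverse]
  exact hQ a _ (by simpa using List.reverse_suffix.2 hl)

theorem foldr_of_size_le_add {h : α → List β} {g : α → σ} {f : α → β → σ → σ}
    (hh : IsPolyTime h) (hg : IsPolyTime g)
    (hf : IsPolyTime fun x : α × β × σ => f x.1 x.2.1 x.2.2) (Q : Polynomial ℕ)
    (hQ : ∀ a b s, size (f a b s) ≤ size s + Q.eval (size (a, b))) :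
    IsPolyTime fun a => (h a).foldr (f a) (g a) := by
  obtain ⟨R, hR⟩ := hh.exists_size_le
  obtain ⟨G, hG⟩ := hg.exists_size_le
  refine foldr hh hg hf (G + R * Q.comp (.X + R + 1)) fun a l hl => ?_
  have hlen : l.length ≤ R.eval (size a) :=
    (hl.sublist.length_le.trans (length_le_size _)).trans (hR a)
  have hsize := size_foldr_le (f := f a) (l := l) (s := g a)
    (D := Q.eval (size a + R.eval (size a) + 1)) fun b hb s => (hQ a b s).trans <| by
      gcongr
      refine polynomial_eval_monotone Q ?_
      rw [size_mk]
      have := (size_le_of_mem (hl.subset hb)).trans (hR a)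
      omega
  simp only [eval_add, eval_mul, eval_X, eval_comp, eval_one]
  exact hsize.trans (Nat.add_le_add (hG a) (Nat.mul_le_mul_right _ hlen))

@[fun_prop]
theorem append {f g : α → List β} (hf : IsPolyTime f) (hg : IsPolyTime g) :
    IsPolyTime fun a => f a ++ g a := by
  simpa using foldr_of_size_le_add (f := fun _ b s => b :: s) hf hg (by fun_prop) (.X + 1)
    fun a b s => by simp; omega

@[fun_prop]
theorem flatMap {h : α → List β} {f : α → β → List γ} (hh : IsPolyTime h)
    (hf : IsPolyTime fun x : α × β => f x.1 x.2) : IsPolyTime fun a => (h a).flatMap (f a) := by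
  obtain ⟨Q, hQ⟩ := hf.exists_size_le
  convert foldr_of_size_le_add (f := fun a b s => f a b ++ s) hh (const [])
    ((hf.comp₂ (by fun_prop) (by fun_prop)).append (by fun_prop)) Q
    (fun a b s => ?_) using 2 with a
  · induction h a with
    | nil => rfl
    | cons b l ih => rw [List.flatMap_cons, ih, List.foldr_cons]
  · have : size (f a b) ≤ _ := hQ (a, b)
    have := size_append (f a b) s
    omega

@[fun_prop]
theorem map {h : α → List β} {f : α → β → γ} (hh : IsPolyTime h)
    (hf : IsPolyTime fun x : α × β => f x.1 x.2) : IsPolyTime fun a => (h a).map (f a) := by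
  simp only [List.map_eq_flatMap]
  fun_prop

@[fun_prop]
theorem product {f : α → List β} {g : α → List γ} (hf : IsPolyTime f) (hg : IsPolyTime g) :
    IsPolyTime fun a => f a ×ˢ g a :=
  flatMap (f := fun a b => (g a).map (Prod.mk b)) hf (by fun_prop)

@[fun_prop]
theorem length {h : α → List β} (hh : IsPolyTime h) : IsPolyTime fun a => (h a).length := by
  convert foldr_of_size_le_add (f := fun _ _ s => s + 1) hh (const 0) (by fun_prop) 2
    (fun a b s => by simp; omega) using 2 with a
  induction h a with
  | nil => rfl
  | cons b l ih => rw [List.length_cons, ih, List.foldr_cons]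

@[fun_prop]
theorem add {f g : α → ℕ} (hf : IsPolyTime f) (hg : IsPolyTime g) :
    IsPolyTime fun a => f a + g a := by
  simpa using (hf.replicate_unit.append hg.replicate_unit).length

@[fun_prop]
theorem sum {h : α → List ℕ} (hh : IsPolyTime h) : IsPolyTime fun a => (h a).sum :=
  foldr_of_size_le_add (f := fun _ b s => b + s) hh (const 0) (by fun_prop) .X
    fun a b s => by simp; omega

@[fun_prop]
theorem mul {f g : α → ℕ} (hf : IsPolyTime f) (hg : IsPolyTime g) :
    IsPolyTime fun a => f a * g a := by
  have : IsPolyTime fun a => ((List.replicate (f a) ()).map fun _ => g a).sum := by fun_prop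
  simpa using this

@[fun_prop]
theorem tail {h : α → List β} (hh : IsPolyTime h) : IsPolyTime fun a => (h a).tail := by
  convert list_cases (g := fun _ _ t => t) hh (const []) (by fun_prop) using 2 with a
  cases h a <;> rfl

@[fun_prop]
theorem headD {h : α → List β} {g : α → β} (hh : IsPolyTime h) (hg : IsPolyTime g) :
    IsPolyTime fun a => (h a).headD (g a) := by
  convert list_cases (g := fun _ b _ => b) hh hg (by fun_prop) using 2 with a
  cases h a <;> rfl

@[fun_prop]
theorem sub {f g : α → ℕ} (hf : IsPolyTime f) (hg : IsPolyTime g) :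
    IsPolyTime fun a => f a - g a := by
  have foldr_tail (n m : ℕ) : (List.replicate m ()).foldr (fun _ s => s.tail)
      (List.replicate n ()) = List.replicate (n - m) () := by
    induction m with
    | zero => rfl
    | succ m ih => rw [List.replicate_succ, List.foldr_cons, ih, List.tail_replicate]; congr 1
  have := foldr_of_size_le_add (f := fun _ _ s => s.tail) hg.replicate_unit hf.replicate_unit
    (by fun_prop) 0 fun a b s => by simpa using size_le_of_sublist s.tail_sublist
  simpa [foldr_tail] using this.length

@[fun_prop]
theorem min {f g : α → ℕ} (hf : IsPolyTime f) (hg : IsPolyTime g) :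
    IsPolyTime fun a => min (f a) (g a) := by
  convert hf.sub (hf.sub hg) using 2
  omega

@[fun_prop]
theorem range {f : α → ℕ} (hf : IsPolyTime f) : IsPolyTime fun a => List.range (f a) := by
  have foldr_length (n : ℕ) : (List.replicate n ()).foldr (fun _ s => s.length :: s) [] =
      (List.range n).reverse := by
    induction n with
    | zero => rfl
    | succ n ih => rw [List.replicate_succ, List.foldr_cons, ih, List.range_succ]; simp
  suffices IsPolyTime fun n => (List.range n).reverse by
    simpa using this.reverse.comp hf
  simp only [← foldr_length]
  refine foldr (f := fun _ _ s => s.length :: s) (by fun_prop) (const []) (by fun_prop)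
    (.X * (2 * .X + 2) + 1) fun n l hl => ?_
  have hl' : l.length ≤ n := by simpa using hl.sublist.length_le
  rw [List.eq_replicate_iff (a := ()) (l := l) |>.2 ⟨rfl, fun _ _ => rfl⟩, foldr_length,
    size_reverse]
  refine (size_list_le (M := 2 * n + 1) fun i hi => ?_).trans ?_
  · rw [size_nat]; linarith [List.mem_range.1 hi]
  · simp only [List.length_range, size_nat, eval_add, eval_mul, eval_X, eval_ofNat, eval_one]
    gcongr <;> omega

end IsPolyTime

/-- The predicate `P` is decided in time polynomial in the size of its argument. -/
@[fun_prop]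
def IsPolyTimePred {α : Type*} [TreeEncodable α] (P : α → Prop) : Prop :=
  ∃ p : α → Bool, IsPolyTime p ∧ ∀ a, p a = true ↔ P a

namespace IsPolyTime

variable {α β : Type*} [TreeEncodable α] [TreeEncodable β]

@[fun_prop]
theorem ite {P : α → Prop} [DecidablePred P] {f g : α → β} (hP : IsPolyTimePred P)
    (hf : IsPolyTime f) (hg : IsPolyTime g) : IsPolyTime fun a => if P a then f a else g a := by
  obtain ⟨p, hp, hpP⟩ := hP
  simpa only [hpP] using hp.bool_ite hf hg

@[fun_prop]
theorem filter {h : α → List β} {P : α → β → Prop} [∀ a, DecidablePred (P a)]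
    (hh : IsPolyTime h) (hP : IsPolyTimePred fun x : α × β => P x.1 x.2) :
    IsPolyTime fun a => (h a).filter fun b => P a b := by
  convert hh.flatMap (f := fun a b => if P a b then [b] else []) (.ite hP (by fun_prop) (const []))
    using 2 with a
  induction h a with
  | nil => rfl
  | cons b l ih => by_cases hb : P a b <;> simp [hb, ih]

end IsPolyTime

namespace IsPolyTimePred

variable {α β : Type*} [TreeEncodable α] [TreeEncodable β]

@[fun_prop]
theorem comp {P : β → Prop} {f : α → β} (hP : IsPolyTimePred P) (hf : IsPolyTime f) :
    IsPolyTimePred fun a => P (f a) := by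
  obtain ⟨p, hp, hpP⟩ := hP
  exact ⟨fun a => p (f a), hp.comp hf, fun a => hpP (f a)⟩

@[fun_prop]
theorem not {P : α → Prop} (hP : IsPolyTimePred P) : IsPolyTimePred fun a => ¬P a := by
  obtain ⟨p, hp, hpP⟩ := hP
  exact ⟨_, hp.bool_ite (.const false) (.const true), fun a => by simp [← hpP]⟩

@[fun_prop]
theorem and {P Q : α → Prop} (hP : IsPolyTimePred P) (hQ : IsPolyTimePred Q) :
    IsPolyTimePred fun a => P a ∧ Q a := by
  obtain ⟨p, hp, hpP⟩ := hP
  obtain ⟨q, hq, hqQ⟩ := hQ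
  exact ⟨_, hp.bool_ite hq (.const false), fun a => by simp [← hpP, ← hqQ]⟩

@[fun_prop]
theorem or {P Q : α → Prop} (hP : IsPolyTimePred P) (hQ : IsPolyTimePred Q) :
    IsPolyTimePred fun a => P a ∨ Q a := by
  simpa only [not_and_or, not_not] using (hP.not.and hQ.not).not

@[fun_prop]
theorem imp {P Q : α → Prop} (hP : IsPolyTimePred P) (hQ : IsPolyTimePred Q) :
    IsPolyTimePred fun a => P a → Q a := by
  simpa only [imp_iff_not_or] using hP.not.or hQ

@[fun_prop]
theorem le {f g : α → ℕ} (hf : IsPolyTime f) (hg : IsPolyTime g) :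
    IsPolyTimePred fun a => f a ≤ g a := by
  have : IsPolyTime fun a => ((List.replicate (f a - g a) ()).map fun _ => false).headD true := by
    fun_prop
  refine ⟨_, this, fun a => ?_⟩
  simp only [← Nat.sub_eq_zero_iff_le]
  cases f a - g a <;> simp [List.replicate_succ]

@[fun_prop]
theorem lt {f g : α → ℕ} (hf : IsPolyTime f) (hg : IsPolyTime g) :
    IsPolyTimePred fun a => f a < g a :=
  le hf.succ hg

@[fun_prop]
theorem nat_eq {f g : α → ℕ} (hf : IsPolyTime f) (hg : IsPolyTime g) :
    IsPolyTimePred fun a => f a = g a := by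
  simpa only [le_antisymm_iff] using (le hf hg).and (le hg hf)

@[fun_prop]
theorem bex {h : α → List β} {P : α → β → Prop} (hh : IsPolyTime h)
    (hP : IsPolyTimePred fun x : α × β => P x.1 x.2) :
    IsPolyTimePred fun a => ∃ b ∈ h a, P a b := by
  classical
  have : IsPolyTimePred fun a => 0 < ((h a).filter fun b => P a b).length := by fun_prop
  simpa only [List.length_filter_pos_iff, decide_eq_true_eq] using this

@[fun_prop]
theorem exists_lt {n : α → ℕ} {P : α → ℕ → Prop} (hn : IsPolyTime n)
    (hP : IsPolyTimePred fun x : α × ℕ => P x.1 x.2) :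
    IsPolyTimePred fun a => ∃ i < n a, P a i := by
  simpa only [List.mem_range] using bex hn.range hP

theorem prod_eq {β γ : Type*} {f g : α → β × γ}
    (h₁ : IsPolyTimePred fun a => (f a).1 = (g a).1)
    (h₂ : IsPolyTimePred fun a => (f a).2 = (g a).2) : IsPolyTimePred fun a => f a = g a := by
  simpa only [Prod.ext_iff] using h₁.and h₂

@[fun_prop]
theorem symbol_eq {f : α → Γ'} (hf : IsPolyTime f) (s : Γ') : IsPolyTimePred fun a => f a = s := by
  have : IsPolyTime symbolIndex := .of_bits_eq fun _ => rfl
  simpa only [symbolIndex_injective.eq_iff] using nat_eq (this.comp hf) (.const (symbolIndex s))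

end IsPolyTimePred

namespace IsPolyTime

variable {α β γ : Type*} [TreeEncodable α] [TreeEncodable β] [TreeEncodable γ]

theorem symbol_cases {s : α → Γ'} {f : α → Γ' → β} (hs : IsPolyTime s)
    (hf : ∀ c, IsPolyTime fun a => f a c) : IsPolyTime fun a => f a (s a) := by
  have : IsPolyTime fun a =>
      if s a = .bit false then f a (.bit false) else if s a = .bit true then f a (.bit true)
      else if s a = .bra then f a .bra else if s a = .ket then f a .ket
      else if s a = .comma then f a .comma else f a .blank := by
    fun_prop
  convert this using 2 with a
  rcases s a with _ | b | _ | _ | _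
  case bit => cases b <;> rfl
  all_goals rfl

@[fun_prop]
theorem countP {h : α → List β} {P : α → β → Prop} [∀ a, DecidablePred (P a)]
    (hh : IsPolyTime h) (hP : IsPolyTimePred fun x : α × β => P x.1 x.2) :
    IsPolyTime fun a => (h a).countP fun b => P a b := by
  simp only [List.countP_eq_length_filter]
  fun_prop

@[fun_prop]
theorem idxOf {c : α → ℕ} {h : α → List ℕ} (hc : IsPolyTime c) (hh : IsPolyTime h) :
    IsPolyTime fun a => (h a).idxOf (c a) := by
  convert foldr_of_size_le_add (f := fun a b s => if b = c a then 0 else s + 1) hh (const 0)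
    (by fun_prop) 2 (fun a b s => by split_ifs <;> simp; omega) using 2 with a
  induction h a with
  | nil => rfl
  | cons b l ih => simp only [List.idxOf_cons, List.foldr_cons, ih, beq_eq_decide, Bool.cond_decide]

@[fun_prop]
theorem nat_bit {b : α → Bool} {n : α → ℕ} (hb : IsPolyTime b) (hn : IsPolyTime n) :
    IsPolyTime fun a => Nat.bit (b a) (n a) := by
  convert hb.bool_ite (f := fun a => 2 * n a + 1) (g := fun a => 2 * n a) (by fun_prop)
    (by fun_prop) using 2 with a
  cases b a <;> rfl

@[fun_prop]
theorem nat_swap {i j n : α → ℕ} (hi : IsPolyTime i) (hj : IsPolyTime j) (hn : IsPolyTime n) :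
    IsPolyTime fun a => Equiv.swap (i a) (j a) (n a) := by
  simp only [Equiv.swap_apply_def]
  fun_prop

theorem foldr_filter {h : α → List β} {u g : α → List γ} {P : α → β → List γ → γ → Prop}
    [∀ a b s, DecidablePred (P a b s)] (hh : IsPolyTime h) (hu : IsPolyTime u) (hg : IsPolyTime g)
    (hP : IsPolyTimePred fun x : (α × β × List γ) × γ => P x.1.1 x.1.2.1 x.1.2.2 x.2) :
    IsPolyTime fun a => (h a).foldr (fun b s => (u a).filter fun c => P a b s c) (g a) := by
  obtain ⟨U, hU⟩ := hu.exists_size_le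
  obtain ⟨G, hG⟩ := hg.exists_size_le
  refine foldr (f := fun a b s => (u a).filter fun c => P a b s c) hh hg
    (filter (P := fun (x : α × β × List γ) c => P x.1 x.2.1 x.2.2 c) (by fun_prop) hP) (U + G)
    fun a l _ => ?_
  rw [Polynomial.eval_add]
  rcases l with _ | ⟨b, l⟩
  · exact (hG a).trans (Nat.le_add_left _ _)
  · exact (size_le_of_sublist List.filter_sublist).trans ((hU a).trans (Nat.le_add_right _ _))

theorem iterate_filter {t : α → ℕ} {u g : α → List γ} {P : α → List γ → γ → Prop}
    [∀ a s, DecidablePred (P a s)] (ht : IsPolyTime t) (hu : IsPolyTime u) (hg : IsPolyTime g)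
    (hP : IsPolyTimePred fun x : (α × List γ) × γ => P x.1.1 x.1.2 x.2) :
    IsPolyTime fun a => (fun s => (u a).filter fun c => P a s c)^[t a] (g a) := by
  have := foldr_filter (P := fun a _ s c => P a s c) ht.replicate_unit hu hg
    (.comp hP (f := fun x : (α × Unit × List γ) × γ => ((x.1.1, x.1.2.2), x.2)) (by fun_prop))
  simpa only [List.foldr_const, List.length_replicate] using this

end IsPolyTime

/-! ### Polynomial-time Turing machines -/

open Turing (TM2ComputableInPolyTime TM2OutputsInTime initList haltList)

/-- Push the code of the symbol in memory, provided that it is in the list. -/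
def pushSymbol : List Γ' → Program
  | [] => skip
  | s :: l => .ite (· == some s) (pushWord (bits s)) (pushSymbol l)

theorem run_pushSymbol {l : List Γ'} {s : Γ'} (hs : s ∈ l) {i : List Γ'} {a x y z : List Bool} :
    Run (pushSymbol l) (some s) (contents i a x y z) (12 + l.length) (some s)
      (contents i (bits s ++ a) x y z) := by
  induction l with
  | nil => simp at hs
  | cons s' l ih =>
    rw [List.length_cons]
    by_cases h : s = s'
    · subst h
      have := size_symbol_le s
      exact (Run.ite_true (by simp) (run_pushWord _)).mono (by grind [size])
    · exact (Run.ite_false (by simpa using h) (ih (by simpa [h] using hs))).mono (by omega)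

/-- The input alphabet. -/
def alphabet : List Γ' := [.bit false, .bit true, .bra, .ket, .comma, .blank]

theorem mem_alphabet (s : Γ') : s ∈ alphabet := by
  revert s; decide

/-- Pop a symbol of the input into memory. -/
def popInput : Program := .pop none fun _ s => s

theorem run_popInput {l : List Γ'} {v : Option Γ'} {a : List Bool} :
    Run popInput v (contents l a [] [] []) 1 l.head? (contents l.tail a [] [] []) := by
  simpa [popInput] using Run.pop (k := none) (f := fun _ s => s) (v := v)
    (S := contents l a [] [] [])

/-- The body of the loop of `loadInput`. -/
def loadSymbol : Program := .seq (pushSymbol alphabet) (.seq (push .main true) popInput)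

/-- Turn the input into a list on the main stack, in reverse order. -/
def loadInput : Program :=
  .seq (push .main false) (.seq popInput (.loop Option.isSome loadSymbol))

theorem run_loop_loadSymbol : ∀ l r : List Γ',
    Run (.loop Option.isSome loadSymbol) l.head? (contents l.tail (bits r) [] [] [])
      (1 + 21 * l.length) none (contents [] (bits (l.reverse ++ r)) [] [] [])
  | [], _ => .loop_done rfl
  | s :: l, r => by
    have hstep : Run loadSymbol (some s) (contents l (bits r) [] [] []) 20 l.head?
        (contents l.tail (bits (s :: r)) [] [] []) :=
      (run_pushSymbol (mem_alphabet s)).seq (run_push_main.seq run_popInput)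
    rw [List.reverse_cons, List.append_assoc, List.length_cons]
    exact (Run.loop_step rfl hstep (run_loop_loadSymbol l (s :: r))).mono (by omega)

theorem run_loadInput (l : List Γ') :
    Run loadInput none (contents l [] [] [] []) (3 + 21 * l.length) none
      (contents [] (bits l.reverse) [] [] []) := by
  have := run_loop_loadSymbol l []
  rw [List.append_nil] at this
  exact (run_push_main.seq (run_popInput.seq this)).mono (by omega)

/-- Replace the code of a Boolean by the Boolean. -/
def finish : Program := ifTop (.seq uncons (.seq uncons (push .main true))) (push .main false)

theorem exec_finish (b : Bool) : Exec finish (bits b) 8 [b] := by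
  cases b
  · exact (exec_ifTop_false run_push_main).mono (by omega)
  · exact exec_ifTop_true (exec_uncons.seq (exec_uncons.seq run_push_main))

theorem nonempty_tm2ComputableInPolyTime {α : Type} {enc : α → List Γ'} {f : α → Bool}
    {p : Program} {P : Polynomial ℕ}
    (h : ∀ a, Run p none (contents (enc a) [] [] [] []) (P.eval (enc a).length) none
      (contents [] [f a] [] [] [])) :
    Nonempty (TM2ComputableInPolyTime enc encodeBool f) := by
  let M := machine p none (some .main) none
  have init_eq (a : α) : initList M ((enc a).map (Equiv.refl Γ').invFun) =
      ⟨some (entry p), none, contents (enc a) [] [] [] []⟩ := by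
    simp only [initList]
    congr 1
    funext k
    rcases k with _ | _ | _ <;> simp [M, machine]
    rfl
  have halt_eq (a : α) : haltList M ((encodeBool (f a)).map (Equiv.refl Bool).invFun) =
      ⟨none, none, contents [] [f a] [] [] []⟩ := by
    simp only [haltList]
    congr 1
    funext k
    rcases k with _ | _ | _ <;> simp [M, machine]
    rfl
  have outputs (a : α) : Nonempty (TM2OutputsInTime M ((enc a).map (Equiv.refl Γ').invFun)
      (some ((encodeBool (f a)).map (Equiv.refl Bool).invFun)) (P.eval (enc a).length)) := by
    unfold TM2OutputsInTime
    rw [init_eq, Option.map_some, halt_eq]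
    exact (h a).evalsWithin fun _ => rfl
  exact ⟨{ tm := M, inputAlphabet := .refl _, outputAlphabet := .refl _, time := P,
           outputsFun := fun a => (outputs a).some }⟩

theorem IsPolyTime.nonempty_tm2ComputableInPolyTime {α : Type} (enc : α → List Γ')
    {g : List Γ' → Bool} (hg : IsPolyTime g) :
    Nonempty (TM2ComputableInPolyTime enc encodeBool fun a => g (enc a)) := by
  obtain ⟨p, P, hp⟩ := hg.comp IsPolyTime.id.reverse
  refine TreeMachine.nonempty_tm2ComputableInPolyTime (p := .seq loadInput (.seq p finish))
    (P := (3 + 21 * .X) + (P.comp (.X * 12 + 1) + 8)) fun a => ?_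
  have hsize : size (enc a).reverse ≤ (enc a).length * 12 + 1 := by
    rw [size_reverse]
    exact size_list_le (M := 11) fun s _ => size_symbol_le s
  have hrun := hp (enc a).reverse []
  simp only [List.reverse_reverse, List.append_nil] at hrun
  refine ((run_loadInput (enc a)).seq (hrun.seq (exec_finish _))).mono ?_
  simpa using polynomial_eval_monotone P hsize

theorem IsPolyTimePred.polyTimeDecidable {α : Type} {enc : α → List Γ'} {P : α → Prop}
    {Q : List Γ' → Prop} (hQ : IsPolyTimePred Q) (h : ∀ a, Q (enc a) ↔ P a) :
    Multiwinner.PolyTimeDecidable enc P := by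
  obtain ⟨g, hg, hgQ⟩ := hQ
  exact ⟨fun a => g (enc a), fun a => (hgQ _).trans (h a),
    hg.nonempty_tm2ComputableInPolyTime enc⟩

end TreeMachine

namespace Multiwinner

/-! ### Changing the winning committees -/

section TopSets

variable {ι R R' : Type*}

/-- The `k`-element sets that contain the elements with the highest values of `s`, ties being
broken arbitrarily. Unlike `bestCommittees`, this notion only refers to the order of the values. -/
def topSets [LE R] (s : ι → R) (k : ℕ) : Set (Finset ι) :=
  {S | S.card = k ∧ ∀ c ∈ S, ∀ d ∉ S, s d ≤ s c}

theorem mem_topSets_iff_sum_le [AddCommMonoid R] [LinearOrder R] [IsOrderedCancelAddMonoid R]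
    {s : ι → R} {k : ℕ} {S : Finset ι} :
    S ∈ topSets s k ↔
      S.card = k ∧ ∀ T : Finset ι, T.card = k → ∑ c ∈ T, s c ≤ ∑ c ∈ S, s c := by
  classical
  refine and_congr_right fun hS => ⟨fun h T hT => ?_, fun h c hc d hd => ?_⟩
  · rw [← Finset.sum_sdiff_le_sum_sdiff]
    have hcard : (T \ S).card = (S \ T).card := Finset.card_sdiff_comm (hT.trans hS.symm)
    obtain he | hne := (S \ T).eq_empty_or_nonempty
    · rw [he, Finset.card_empty, Finset.card_eq_zero] at hcard
      rw [he, hcard]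
    · obtain ⟨c, hc, hmin⟩ := (S \ T).exists_min_image s hne
      calc ∑ x ∈ T \ S, s x ≤ (T \ S).card • s c :=
            Finset.sum_le_card_nsmul _ _ _ fun d hd =>
              h c (Finset.mem_sdiff.1 hc).1 d (Finset.mem_sdiff.1 hd).2
        _ = (S \ T).card • s c := by rw [hcard]
        _ ≤ ∑ x ∈ S \ T, s x := Finset.card_nsmul_le_sum _ _ _ hmin
  · have hd' : d ∉ S.erase c := fun hd' => hd (Finset.mem_of_mem_erase hd')
    have hsum := h (insert d (S.erase c)) (by
      rw [Finset.card_insert_of_notMem hd', Finset.card_erase_add_one hc, hS])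
    rw [Finset.sum_insert hd', ← Finset.add_sum_erase S s hc] at hsum
    exact le_of_add_le_add_right hsum

theorem topSets_nonempty [Fintype ι] [LinearOrder R] (s : ι → R) {k : ℕ}
    (hk : k ≤ Fintype.card ι) : (topSets s k).Nonempty := by
  classical
  induction k with
  | zero => exact ⟨∅, rfl, by simp⟩
  | succ k ih =>
    obtain ⟨S, rfl, hS⟩ := ih (Nat.le_of_succ_le hk)
    obtain ⟨d, hd, hmax⟩ := Sᶜ.exists_max_image s
      (Finset.card_pos.1 (by rw [Finset.card_compl]; omega))
    refine ⟨insert d S, Finset.card_insert_of_notMem (Finset.mem_compl.1 hd), fun c hc e he => ?_⟩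
    obtain ⟨-, heS⟩ := not_or.1 (Finset.mem_insert.not.1 he)
    obtain rfl | hcS := Finset.mem_insert.1 hc
    · exact hmax e (Finset.mem_compl.2 heS)
    · exact hS c hcS e heS

variable [LinearOrder R] [LinearOrder R'] {s : ι → R} {k : ℕ} {S : Finset ι} {c d : ι}

theorem exchange_mem_topSets [DecidableEq ι] (hS : S ∈ topSets s k) (hc : c ∈ S) (hd : d ∉ S)
    (hcd : s c ≤ s d) : insert d (S.erase c) ∈ topSets s k := by
  obtain ⟨rfl, h⟩ := hS
  refine ⟨?_, fun x hx y hy => ?_⟩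
  · rw [Finset.card_insert_of_notMem fun hd' => hd (Finset.mem_of_mem_erase hd'),
      Finset.card_erase_add_one hc]
  · have hyc : s y ≤ s c := by
      by_cases hyS : y ∈ S
      · obtain rfl : y = c := by
          by_contra hne
          exact hy (Finset.mem_insert_of_mem (Finset.mem_erase.2 ⟨hne, hyS⟩))
        rfl
      · exact h c hc y hyS
    obtain rfl | hx := Finset.mem_insert.1 hx
    · exact hyc.trans hcd
    · exact (hyc.trans hcd).trans (h x (Finset.mem_of_mem_erase hx) d hd)

theorem exists_mem_topSets_separating_iff [Fintype ι] (hk : k ≤ Fintype.card ι) :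
    (∃ S ∈ topSets s k, c ∈ S ∧ d ∉ S) ↔
      c ≠ d ∧ (Finset.univ.filter fun x => s c < s x).card < k ∧
        k < (Finset.univ.filter fun x => s d ≤ s x).card := by
  classical
  constructor
  · rintro ⟨S, ⟨rfl, h⟩, hc, hd⟩
    refine ⟨fun hcd => hd (hcd ▸ hc), Finset.card_lt_card ?_, Finset.card_lt_card ?_⟩
    · refine (Finset.ssubset_iff_of_subset fun x hx => ?_).2 ⟨c, hc, by simp⟩
      by_contra hxS
      exact (h c hc x hxS).not_gt (Finset.mem_filter.1 hx).2
    · refine (Finset.ssubset_iff_of_subset fun x hx => ?_).2 ⟨d, by simp, hd⟩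
      exact Finset.mem_filter.2 ⟨Finset.mem_univ x, h x hx d hd⟩
  · rintro ⟨hcd, hc, hd⟩
    obtain ⟨S, hS, hcS⟩ : ∃ S ∈ topSets s k, c ∈ S := by
      obtain ⟨S, hS⟩ := topSets_nonempty s hk
      by_cases hcS : c ∈ S
      · exact ⟨S, hS, hcS⟩
      obtain ⟨x, hxS, hx⟩ := Finset.exists_mem_notMem_of_card_lt_card (hS.1 ▸ hc)
      exact ⟨_, exchange_mem_topSets hS hxS hcS (by simpa using hx), Finset.mem_insert_self _ _⟩
    by_cases hdS : d ∈ S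
    · obtain ⟨y, hy, hyS⟩ := Finset.exists_mem_notMem_of_card_lt_card (hS.1 ▸ hd)
      have hdy : d ≠ y := fun hdy => hyS (hdy ▸ hdS)
      exact ⟨_, exchange_mem_topSets hS hdS hyS (by simpa using hy), by simp [hcd, hcS],
        by simp [hdy]⟩
    · exact ⟨S, hS, hcS, hdS⟩

theorem topSets_ne_iff_exists_separating [Fintype ι] (hk : k ≤ Fintype.card ι) {s' : ι → R'} :
    topSets s' k ≠ topSets s k ↔ ∃ c d, (∃ S ∈ topSets s k, c ∈ S ∧ d ∉ S) ∧
      s' c ≤ s' d ∧ (s c = s d → s' c < s' d) := by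
  classical
  constructor
  · intro hne
    by_contra! hcon
    obtain ⟨S, hS⟩ := topSets_nonempty s hk
    have hle : ∀ T ∈ topSets s k, ∀ c ∈ T, ∀ d ∉ T, s' d ≤ s' c := fun T hT c hc d hd => by
      by_contra! hlt
      exact (hcon c d ⟨T, hT, hc, hd⟩ hlt.le).2.not_gt hlt
    refine hne (Set.Subset.antisymm (fun T hT => ⟨hT.1, fun c hc d hd => ?_⟩) fun T hT =>
      ⟨hT.1, hle T hT⟩)
    have heq : ∀ a ∈ T, a ∉ S → ∀ b ∈ S, b ∉ T → s b = s a := fun a haT haS b hbS hbT =>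
      (hcon b a ⟨S, hS, hbS, haS⟩ (hT.2 a haT b hbT)).1
    have hcard : T.card = S.card := hT.1.trans hS.1.symm
    by_cases hcS : c ∈ S <;> by_cases hdS : d ∈ S
    · obtain ⟨a, haT, haS⟩ : ∃ a ∈ T, a ∉ S := by
        by_contra! hsub
        exact hd (Finset.eq_of_subset_of_card_le hsub hcard.ge ▸ hdS)
      exact (heq a haT haS d hdS hd).trans_le (hS.2 c hcS a haS)
    · exact hS.2 c hcS d hdS
    · exact (heq c hc hcS d hdS hd).le
    · obtain ⟨b, hbS, hbT⟩ : ∃ b ∈ S, b ∉ T := by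
        by_contra! hsub
        exact hcS (Finset.eq_of_subset_of_card_le hsub hcard.le ▸ hc)
      exact (hS.2 b hbS d hdS).trans_eq (heq c hc hcS b hbS hbT)
  · rintro ⟨c, d, ⟨S, hS, hc, hd⟩, hle, hlt⟩ heq
    have hS' : S ∈ topSets s' k := heq ▸ hS
    have hex : insert d (S.erase c) ∈ topSets s k := heq ▸ exchange_mem_topSets hS' hc hd hle
    have hcd : s c ≤ s d := hex.2 d (Finset.mem_insert_self _ _) c
      (by simp [show c ≠ d from fun hcd => hd (hcd ▸ hc)])
    exact (hS'.2 c hc d hd).not_gt (hlt (hcd.antisymm (hS.2 c hc d hd)))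

theorem topSets_ne_iff [Fintype ι] (hk : k ≤ Fintype.card ι) {s' : ι → R'} :
    topSets s' k ≠ topSets s k ↔ ∃ c d,
      (c ≠ d ∧ (Finset.univ.filter fun x => s c < s x).card < k ∧
        k < (Finset.univ.filter fun x => s d ≤ s x).card) ∧
      s' c ≤ s' d ∧ (s c = s d → s' c < s' d) := by
  simp only [topSets_ne_iff_exists_separating hk, exists_mem_topSets_separating_iff hk]

end TopSets

theorem bestCommittees_eq_topSets {m n : ℕ} (γ : ℕ → ℤ) (E : Election m n) (k : ℕ) :
    bestCommittees γ E k = topSets (score γ E) k :=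
  Set.ext fun _ => mem_topSets_iff_sum_le.symm

/-! ### Swaps and the places of two candidates -/

section Path

variable {α β : Type*} {r : α → α → Prop} {r' : β → β → Prop} {n t : ℕ} {a b c : α}

/-- `Path r n a b`: exactly `n` successive steps of the relation `r` lead from `a` to `b`. -/
inductive Path (r : α → α → Prop) : ℕ → α → α → Prop
  | refl (a : α) : Path r 0 a a
  | step {n : ℕ} {a b c : α} : Path r n a b → r b c → Path r (n + 1) a c

namespace Path

theorem trans (h : Path r n a b) (h' : Path r t b c) : Path r (n + t) a c := by
  induction h' with
  | refl => exact h
  | step _ hr ih => exact (ih h).step hr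

theorem exists_of_add (h : Path r (n + t) a b) : ∃ c, Path r n a c ∧ Path r t c b := by
  induction t generalizing b with
  | zero => exact ⟨b, h, .refl b⟩
  | succ t ih =>
    cases h with
    | step h hr =>
      obtain ⟨c, hac, hcb⟩ := ih h
      exact ⟨c, hac, hcb.step hr⟩

theorem map_iff (f : α → β) (hf : ∀ a b, r' (f a) b ↔ ∃ a', r a a' ∧ f a' = b) {b : β} :
    Path r' n (f a) b ↔ ∃ a', Path r n a a' ∧ f a' = b := by
  constructor
  · intro h
    generalize hp : f a = p at h
    induction h with
    | refl => exact ⟨a, .refl a, hp⟩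
    | step _ hr ih =>
      obtain ⟨a', ha', rfl⟩ := ih hp
      obtain ⟨a'', hr', rfl⟩ := (hf _ _).1 hr
      exact ⟨a'', ha'.step hr', rfl⟩
  · rintro ⟨a', h, rfl⟩
    induction h with
    | refl => exact .refl _
    | step _ hr ih => exact ih.step ((hf _ _).2 ⟨_, hr, rfl⟩)

theorem exists_le_card (h : Path r n a b) {s : Finset α} (hs : ∀ i c, Path r i a c → c ∈ s) :
    ∃ n' ≤ n, n' ≤ s.card ∧ Path r n' a b := by
  classical
  have hex : ∃ n, Path r n a b := ⟨n, h⟩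
  refine ⟨Nat.find hex, Nat.find_min' hex h, ?_, Nat.find_spec hex⟩
  have hsplit : ∀ i ≤ Nat.find hex, ∃ c, Path r i a c ∧ Path r (Nat.find hex - i) c b :=
    fun i hi => exists_of_add (by rw [Nat.add_sub_cancel' hi]; exact Nat.find_spec hex)
  have : Nonempty α := ⟨a⟩
  choose! f hf hf' using hsplit
  have hinj : ∀ i j, i < j → j ≤ Nat.find hex → f i ≠ f j := fun i j hij hj hfij => by
    have := Nat.find_min' hex ((hf i (hij.le.trans hj)).trans (hfij ▸ hf' j hj))
    omega
  by_contra! hlt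
  obtain ⟨i, hi, j, hj, hij, hfij⟩ := Finset.exists_ne_map_eq_of_card_lt_of_maps_to
    (s := Finset.range (Nat.find hex + 1)) (t := s) (f := f)
    (by rw [Finset.card_range]; omega)
    fun i hi => hs i _ (hf i (Nat.lt_succ_iff.1 (Finset.mem_range.1 hi)))
  simp only [Finset.mem_range, Nat.lt_succ_iff] at hi hj
  obtain h | h := lt_or_gt_of_ne hij
  · exact hinj i j h hj hfij
  · exact hinj j i h hi hfij.symm

end Path

variable {ι : Type*} [DecidableEq ι]

/-- The relation between families that differ by one step of `r` in a single component. -/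
def UpdateStep (r : α → α → Prop) (f g : ι → α) : Prop :=
  ∃ i b, r (f i) b ∧ g = Function.update f i b

theorem Path.update {f : ι → α} {i : ι} (h : Path r n (f i) b) :
    Path (UpdateStep r) n f (Function.update f i b) := by
  generalize hp : f i = p at h
  induction h with
  | refl => rw [← hp, Function.update_eq_self]; exact .refl f
  | step _ hr ih => exact (ih hp).step ⟨i, _, by simpa using hr, by simp⟩

theorem path_updateStep_iff [Fintype ι] {f g : ι → α} :
    Path (UpdateStep r) n f g ↔ ∃ τ : ι → ℕ, ∑ i, τ i = n ∧ ∀ i, Path r (τ i) (f i) (g i) := by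
  constructor
  · intro h
    induction h with
    | refl => exact ⟨0, by simp, fun i => .refl _⟩
    | step _ hr ih =>
      obtain ⟨τ, rfl, hτ⟩ := ih
      obtain ⟨i, b, hr, rfl⟩ := hr
      refine ⟨τ + Pi.single i 1, by simp [Finset.sum_add_distrib], fun j => ?_⟩
      obtain rfl | hj := eq_or_ne j i
      · simpa using (hτ j).step hr
      · simpa [hj] using hτ j
  · rintro ⟨τ, rfl, hτ⟩
    have hpart (s : Finset ι) : Path (UpdateStep r) (∑ i ∈ s, τ i) f (s.piecewise g f) := by
      induction s using Finset.induction_on with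
      | empty => simpa using Path.refl f
      | insert i s hi ih =>
        rw [Finset.sum_insert hi, add_comm, Finset.piecewise_insert]
        exact ih.trans (Path.update (by simpa [hi] using hτ i))
    simpa using hpart Finset.univ

end Path

section Swaps

variable {m n t : ℕ}

/-- `RankingSwap v v'`: the ranking `v'` arises from `v` by swapping two adjacent candidates. -/
def RankingSwap (v v' : Ranking m) : Prop :=
  ∃ (i : ℕ) (h : i + 1 < m),
    v' = (Equiv.swap (⟨i, Nat.lt_of_succ_lt h⟩ : Fin m) ⟨i + 1, h⟩).trans v

theorem reachableBySwaps_iff {E E' : Election m n} :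
    ReachableBySwaps t E E' ↔
      ∃ τ : Fin n → ℕ, ∑ v, τ v = t ∧ ∀ v, Path RankingSwap (τ v) (E v) (E' v) := by
  have hswap {E E' : Election m n} : AdjacentSwap E E' ↔ UpdateStep RankingSwap E E' := by
    simp only [AdjacentSwap, UpdateStep, RankingSwap]
    aesop
  rw [← path_updateStep_iff]
  constructor <;> intro h
  · induction h with
    | refl => exact .refl _
    | step _ hs ih => exact ih.step (hswap.1 hs)
  · induction h with
    | refl => exact .refl _
    | step _ hs ih => exact ih.step (hswap.2 hs)

/-- `PlaceSwap m p q`: exchanging two adjacent ones of the places `0, …, m - 1` moves the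
elements on the places `p.1` and `p.2` to the places `q.1` and `q.2`. -/
def PlaceSwap (m : ℕ) (p q : ℕ × ℕ) : Prop :=
  ∃ i < m - 1, q = (Equiv.swap i (i + 1) p.1, Equiv.swap i (i + 1) p.2)

instance : DecidableRel (PlaceSwap m) := fun _ _ => inferInstanceAs (Decidable (∃ _ < _, _))

/-- The places of the candidates `c` and `d` in the ranking `v`, the top place being `0`. -/
def places (v : Ranking m) (c d : Fin m) : ℕ × ℕ := (v.symm c, v.symm d)

theorem places_mem (v : Ranking m) (c d : Fin m) :
    places v c d ∈ Finset.range m ×ˢ Finset.range m := by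
  simp [places]

theorem PlaceSwap.mem {p q : ℕ × ℕ} (h : PlaceSwap m p q)
    (hp : p ∈ Finset.range m ×ˢ Finset.range m) : q ∈ Finset.range m ×ˢ Finset.range m := by
  obtain ⟨i, hi, rfl⟩ := h
  simp only [Finset.mem_product, Finset.mem_range, Equiv.swap_apply_def] at hp ⊢
  split_ifs <;> omega

theorem path_placeSwap_mem {p q : ℕ × ℕ} (h : Path (PlaceSwap m) t p q)
    (hp : p ∈ Finset.range m ×ˢ Finset.range m) : q ∈ Finset.range m ×ˢ Finset.range m := by
  induction h with
  | refl => exact hp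
  | step _ hr ih => exact hr.mem (ih hp)

theorem placeSwap_places_iff {v : Ranking m} {c d : Fin m} {q : ℕ × ℕ} :
    PlaceSwap m (places v c d) q ↔ ∃ v', RankingSwap v v' ∧ places v' c d = q := by
  have hval (i : ℕ) (h : i + 1 < m) (x : Fin m) :
      (Equiv.swap (⟨i, Nat.lt_of_succ_lt h⟩ : Fin m) ⟨i + 1, h⟩ x : ℕ) =
        Equiv.swap i (i + 1) (x : ℕ) :=
    Fin.val_injective.map_swap _ _ x
  constructor
  · rintro ⟨i, hi, rfl⟩
    exact ⟨_, ⟨i, by omega, rfl⟩, by simp [places, hval]⟩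
  · rintro ⟨v', ⟨i, hi, rfl⟩, rfl⟩
    exact ⟨i, by omega, by simp [places, hval]⟩

theorem path_placeSwap_iff {v : Ranking m} {c d : Fin m} {q : ℕ × ℕ} :
    Path (PlaceSwap m) t (places v c d) q ↔ ∃ v', Path RankingSwap t v v' ∧ places v' c d = q :=
  Path.map_iff (fun v => places v c d) fun _ _ => placeSwap_places_iff

theorem exists_reachableBySwaps_le {E E' : Election m n} (h : ReachableBySwaps t E E')
    (c d : Fin m) :
    ∃ t' ≤ t, t' ≤ n * (m * m) ∧ ∃ E'' : Election m n, ReachableBySwaps t' E E'' ∧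
      ∀ v, places (E'' v) c d = places (E' v) c d := by
  obtain ⟨τ, rfl, hτ⟩ := reachableBySwaps_iff.1 h
  have hshort (v : Fin n) : ∃ t' ≤ τ v, t' ≤ m * m ∧ ∃ r, Path RankingSwap t' (E v) r ∧
      places r c d = places (E' v) c d := by
    obtain ⟨t', ht', hcard, hpath⟩ := (path_placeSwap_iff.2 ⟨_, hτ v, rfl⟩).exists_le_card
      fun _ _ h => path_placeSwap_mem h (places_mem (E v) c d)
    exact ⟨t', ht', by simpa using hcard, path_placeSwap_iff.1 hpath⟩
  choose τ' hτ' hcard E'' hE'' hplaces using hshort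
  refine ⟨∑ v, τ' v, Finset.sum_le_sum fun v _ => hτ' v, ?_, E'',
    reachableBySwaps_iff.2 ⟨τ', rfl, hE''⟩, hplaces⟩
  simpa using Finset.sum_le_card_nsmul Finset.univ τ' (m * m) fun v _ => hcard v

end Swaps

open Computability (Γ' encodeNat encodeNum encodePosNum)

/-! ### Reading the input -/

section Parsing

/-- One step of reading an encoded instance from right to left. The state is a list of blocks,
each of which is a list of numbers, each of which is a list of digits. -/
def parseStep : Γ' → List (List (List Bool)) → List (List (List Bool))
  | .bra, s => [] :: s
  | .comma, s => ([] :: s.headD []) :: s.tail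
  | .bit b, s => ((b :: (s.headD []).headD []) :: (s.headD []).tail) :: s.tail
  | .ket, s => s
  | .blank, s => s

/-- The blocks of an encoded instance: first the numbers `m`, `k` and `B`, then the rankings. -/
def parse (l : List Γ') : List (List (List Bool)) := l.foldr parseStep [[]]

/-- The minimum of `L` and the number with the binary digits `l`, least significant first. The
number itself may be too large to be written in unary. -/
def cutValue (L : ℕ) (l : List Bool) : ℕ := l.foldr (fun b v => min L (Nat.bit b v)) 0

/-- The candidates of a ranking from the most to the least preferred one. -/
def rankingList {m : ℕ} (v : Ranking m) : List ℕ := List.ofFn fun i => (v i : ℕ)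

/-- The rankings of an election as lists. -/
def rankings {m n : ℕ} (E : Election m n) : List (List ℕ) := List.ofFn fun v => rankingList (E v)

variable {m : ℕ}

theorem foldr_parseStep_digits (l : List Bool) (b : List (List Bool))
    (s : List (List (List Bool))) :
    (l.map Γ'.bit ++ [Γ'.comma]).foldr parseStep (b :: s) = (l :: b) :: s := by
  induction l with
  | nil => rfl
  | cons x l ih => rw [List.map_cons, List.cons_append, List.foldr_cons, ih]; rfl

theorem foldr_parseStep_unary (a : ℕ) (b : List (List Bool)) (s : List (List (List Bool))) :
    (encodeUnary a).foldr parseStep (b :: s) = (List.replicate a true :: b) :: s := by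
  simpa [encodeUnary] using foldr_parseStep_digits (List.replicate a true) b s

theorem foldr_parseStep_flatMap_unary (l : List ℕ) (s : List (List (List Bool))) :
    (l.flatMap encodeUnary).foldr parseStep ([] :: s) =
      l.map (fun a => List.replicate a true) :: s := by
  induction l with
  | nil => rfl
  | cons a l ih =>
    rw [List.flatMap_cons, List.foldr_append, ih, foldr_parseStep_unary, List.map_cons]

theorem encodeRanking_eq (v : Ranking m) :
    encodeRanking v = [Γ'.bra] ++ (rankingList v).flatMap encodeUnary ++ [Γ'.ket] := by
  simp [encodeRanking, rankingList, List.flatMap_def, List.map_ofFn, Function.comp_def]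

theorem foldr_parseStep_ranking (v : Ranking m) (s : List (List (List Bool))) :
    (encodeRanking v).foldr parseStep ([] :: s) =
      [] :: (rankingList v).map (fun a => List.replicate a true) :: s := by
  rw [encodeRanking_eq, List.foldr_append, List.foldr_append]
  exact congrArg ([] :: ·) (foldr_parseStep_flatMap_unary _ s)

theorem foldr_parseStep_flatMap_ranking (l : List (Ranking m)) :
    (l.flatMap encodeRanking).foldr parseStep [[]] =
      [] :: l.map fun v => (rankingList v).map fun a => List.replicate a true := by
  induction l with
  | nil => rfl
  | cons v l ih =>
    rw [List.flatMap_cons, List.foldr_append, ih, foldr_parseStep_ranking, List.map_cons]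

theorem parse_encodeInstance (I : Instance) :
    parse (encodeInstance I) =
      [List.replicate I.m true, List.replicate I.k true, encodeNat I.B] ::
      (List.ofFn I.election).map fun v => (rankingList v).map fun a => List.replicate a true := by
  have hrankings : (List.ofFn fun v => encodeRanking (I.election v)).flatten =
      (List.ofFn I.election).flatMap encodeRanking := by
    rw [List.flatMap_def, List.map_ofFn]; rfl
  rw [parse, encodeInstance, hrankings, List.foldr_append, List.foldr_append, List.foldr_append,
    foldr_parseStep_flatMap_ranking, encodeBinary, foldr_parseStep_digits, foldr_parseStep_unary,
    foldr_parseStep_unary]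

theorem cutValue_cons {L n : ℕ} {b : Bool} {l : List Bool} (h : cutValue L l = min L n) :
    cutValue L (b :: l) = min L (Nat.bit b n) := by
  rw [cutValue, List.foldr_cons, ← cutValue, h]
  cases b <;> simp only [Nat.bit_false, Nat.bit_true] <;> omega

theorem cutValue_encodePosNum (L : ℕ) (n : PosNum) :
    cutValue L (encodePosNum n) = min L (n : ℕ) := by
  induction n with
  | one => exact cutValue_cons (n := 0) (by simp [cutValue])
  | bit0 n ih => simpa [encodePosNum, Nat.bit_false, two_mul] using cutValue_cons (b := false) ih
  | bit1 n ih => simpa [encodePosNum, Nat.bit_true, two_mul] using cutValue_cons (b := true) ih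

theorem cutValue_encodeNat (L n : ℕ) : cutValue L (encodeNat n) = min L n := by
  have hnum (a : Num) : cutValue L (encodeNum a) = min L (a : ℕ) := by
    cases a with
    | zero => simp [encodeNum, cutValue]
    | pos a => exact cutValue_encodePosNum L a
  simpa [encodeNat] using hnum n

end Parsing

/-! ### The dynamic program -/

section Algorithm

/-- The points of the candidate `c`, when every ranking in `P` contributes `w i` for the place
`i = 0, 1, …` of `c`. -/
def points (w : ℕ → ℕ) (P : List (List ℕ)) (c : ℕ) : ℕ := (P.map fun r => w (r.idxOf c)).sum

/-- The pairs of places to which exactly `t` exchanges of adjacent places can move the pair `p`. -/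
def placesAfter (m t : ℕ) (p : ℕ × ℕ) : List (ℕ × ℕ) :=
  (fun X => (List.range m ×ˢ List.range m).filter fun q => ∃ p ∈ X, PlaceSwap m p q)^[t] [p]

/-- The pairs of places to which `t ≤ T` exchanges can move the pair `p`, together with `t`. -/
def movesTo (m T : ℕ) (p : ℕ × ℕ) : List (ℕ × ℕ × ℕ) :=
  (List.range (T + 1)).flatMap fun t => (placesAfter m t p).map fun q => (t, q)

/-- The sums of one element of each of the lists `Xs`, computed one list at a time. All
intermediate results outside of `box` are discarded, so that they remain few. -/
def boundedSums {M : Type*} [AddMonoid M] [DecidableEq M] (box : List M) (Xs : List (List M)) :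
    List M :=
  Xs.foldr (fun X S => box.filter fun q => ∃ p ∈ S, ∃ o ∈ X, q = o + p) [0]

/-- The triples of numbers that are at most `T`, `M` and `M`, respectively. -/
def outcomeBox (T M : ℕ) : List (ℕ × ℕ × ℕ) :=
  List.range (T + 1) ×ˢ (List.range (M + 1) ×ˢ List.range (M + 1))

/-- The triples `(t, x, y)` such that `t ≤ T` swaps can give the candidate `c` exactly `x` points
and the candidate `d` exactly `y` points. -/
def outcomes (w : ℕ → ℕ) (m T : ℕ) (P : List (List ℕ)) (c d : ℕ) : List (ℕ × ℕ × ℕ) :=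
  boundedSums (outcomeBox T (P.length * m))
    (P.map fun r => (movesTo m T (r.idxOf c, r.idxOf d)).map fun o => (o.1, w o.2.1, w o.2.2))

/-- The criterion that the algorithm evaluates: within `T` swaps, a candidate `d` can catch up with
a candidate `c`, or overtake it if they were tied before. The two counts say that some winning
committee contains `c` but not `d`. -/
def Changeable (w : ℕ → ℕ) (m k T : ℕ) (P : List (List ℕ)) : Prop :=
  ∃ c < m, ∃ d < m,
    (¬c = d ∧ ((List.range m).countP fun x => points w P c < points w P x) < k ∧
      k < (List.range m).countP fun x => points w P d ≤ points w P x) ∧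
    ∃ q ∈ outcomes w m T P c d,
      q.2.1 ≤ q.2.2 ∧ (points w P c = points w P d → q.2.1 < q.2.2)

/-- The criterion `Changeable` for the blocks of an encoded instance. -/
def ChangeableBlocks (w : ℕ → ℕ → ℕ → ℕ) (b : List (List (List Bool))) : Prop :=
  let numbers := b.headD []
  let m := (numbers.headD []).length
  let k := (numbers.tail.headD []).length
  Changeable (w m k) m k (cutValue (b.tail.length * (m * m)) (numbers.tail.tail.headD []))
    (b.tail.map fun r => r.map List.length)

theorem changeableBlocks_parse (w : ℕ → ℕ → ℕ → ℕ) (I : Instance) :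
    ChangeableBlocks w (parse (encodeInstance I)) ↔
      Changeable (w I.m I.k) I.m I.k (min (I.n * (I.m * I.m)) I.B)
        (rankings I.election) := by
  simp [rankings, List.map_ofFn, parse_encodeInstance, ChangeableBlocks, cutValue_encodeNat,
    Function.comp_def]

theorem mem_placesAfter {m t : ℕ} {p q : ℕ × ℕ} (hp : p ∈ Finset.range m ×ˢ Finset.range m) :
    q ∈ placesAfter m t p ↔ Path (PlaceSwap m) t p q := by
  induction t generalizing q with
  | zero =>
    simp only [placesAfter, Function.iterate_zero, id_eq, List.mem_singleton]
    exact ⟨fun h => h ▸ .refl q, fun h => by cases h; rfl⟩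
  | succ t ih =>
    have hbox (q : ℕ × ℕ) :
        q ∈ List.range m ×ˢ List.range m ↔ q ∈ Finset.range m ×ˢ Finset.range m :=
      List.pair_mem_product.trans (by simp)
    rw [placesAfter, Function.iterate_succ_apply', ← placesAfter, List.mem_filter, hbox]
    simp only [ih, decide_eq_true_eq]
    constructor
    · rintro ⟨-, p', hp', h⟩
      exact hp'.step h
    · intro h
      refine ⟨path_placeSwap_mem h hp, ?_⟩
      cases h with
      | step h hr => exact ⟨_, h, hr⟩

theorem mem_movesTo {m T t : ℕ} {p q : ℕ × ℕ} (hp : p ∈ Finset.range m ×ˢ Finset.range m) :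
    (t, q) ∈ movesTo m T p ↔ t ≤ T ∧ Path (PlaceSwap m) t p q := by
  simp [movesTo, mem_placesAfter hp]

theorem mem_outcomeBox {T M : ℕ} {q : ℕ × ℕ × ℕ} :
    q ∈ outcomeBox T M ↔ q.1 ≤ T ∧ q.2.1 ≤ M ∧ q.2.2 ≤ M := by
  refine List.pair_mem_product.trans (and_congr (by simp) ?_)
  exact List.pair_mem_product.trans (by simp)

open scoped Pointwise in
theorem mem_boundedSums {M : Type*} [AddMonoid M] [DecidableEq M] {box : List M}
    (h₀ : 0 ∈ box) (hbox : ∀ p q : M, p + q ∈ box → q ∈ box) {Xs : List (List M)} {q : M} :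
    q ∈ boundedSums box Xs ↔ q ∈ box ∧ q ∈ (Xs.map fun X => {x | x ∈ X}).sum := by
  induction Xs generalizing q with
  | nil =>
    simp only [boundedSums, List.foldr_nil, List.mem_singleton, List.map_nil, List.sum_nil,
      Set.mem_zero]
    exact ⟨fun h => ⟨h ▸ h₀, h⟩, fun h => h.2⟩
  | cons X Xs ih =>
    rw [boundedSums, List.foldr_cons, ← boundedSums, List.mem_filter, List.map_cons,
      List.sum_cons, Set.mem_add]
    simp only [ih, decide_eq_true_eq, Set.mem_ofPred_eq]
    refine and_congr_right fun hq => ⟨?_, ?_⟩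
    · rintro ⟨p, ⟨-, hp⟩, o, ho, rfl⟩
      exact ⟨o, ho, p, hp, rfl⟩
    · rintro ⟨o, ho, p, hp, rfl⟩
      exact ⟨p, ⟨hbox o p hq, hp⟩, o, ho, rfl⟩

end Algorithm

section Correctness

variable {m n k t : ℕ} {w : ℕ → ℕ}

theorem idxOf_rankingList (v : Ranking m) (c : Fin m) :
    (rankingList v).idxOf (c : ℕ) = v.symm c := by
  have hnodup : (rankingList v).Nodup :=
    List.nodup_ofFn.2 (Fin.val_injective.comp v.injective)
  have hlt : (v.symm c : ℕ) < (rankingList v).length := by simp [rankingList]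
  rw [← hnodup.idxOf_getElem _ hlt]
  simp [rankingList]

theorem points_rankings (E : Election m n) (c : Fin m) :
    points w (rankings E) c = ∑ v, w ((E v).symm c) := by
  simp [points, rankings, List.map_ofFn, List.sum_ofFn, idxOf_rankingList]

theorem mem_map_movesTo {T x y : ℕ} {v : Ranking m} {c d : Fin m} :
    (t, x, y) ∈ (movesTo m T ((rankingList v).idxOf (c : ℕ), (rankingList v).idxOf (d : ℕ))).map
        (fun o => (o.1, w o.2.1, w o.2.2)) ↔
      t ≤ T ∧ ∃ v', Path RankingSwap t v v' ∧ w (v'.symm c) = x ∧ w (v'.symm d) = y := by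
  rw [idxOf_rankingList, idxOf_rankingList, ← places]
  simp only [List.mem_map, Prod.exists, mem_movesTo (places_mem v c d), path_placeSwap_iff]
  constructor
  · rintro ⟨_, _, _, ⟨hT, v', hv', ⟨⟩⟩, ⟨⟩⟩
    exact ⟨hT, v', hv', rfl, rfl⟩
  · rintro ⟨hT, v', hv', rfl, rfl⟩
    exact ⟨_, _, _, ⟨hT, v', hv', rfl⟩, rfl⟩

open scoped Pointwise in
theorem mem_outcomes (hw : ∀ i < m, w i ≤ m) {T x y : ℕ} {E : Election m n} {c d : Fin m} :
    (t, x, y) ∈ outcomes w m T (rankings E) c d ↔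
      t ≤ T ∧ ∃ E' : Election m n, ReachableBySwaps t E E' ∧
        points w (rankings E') c = x ∧ points w (rankings E') d = y := by
  have hbound (E' : Election m n) (c : Fin m) : points w (rankings E') c ≤ n * m := by
    simpa [points_rankings] using
      Finset.sum_le_card_nsmul Finset.univ _ m fun v _ => hw _ ((E' v).symm c).is_lt
  rw [outcomes, mem_boundedSums (by simp [mem_outcomeBox])
      (fun p q => by simp only [mem_outcomeBox, Prod.fst_add, Prod.snd_add]; omega),
    mem_outcomeBox, rankings, List.length_ofFn, List.map_ofFn, List.map_ofFn, List.sum_ofFn,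
    Set.mem_fintype_sum]
  simp only [Prod.ext_iff, Prod.fst_sum, Prod.snd_sum]
  constructor
  · rintro ⟨⟨hT, -⟩, o, ho, rfl, rfl, rfl⟩
    choose _ E' hE' hc hd using fun v => mem_map_movesTo.1 (ho v)
    exact ⟨hT, E', reachableBySwaps_iff.2 ⟨_, rfl, hE'⟩, by simp [points_rankings, hc],
      by simp [points_rankings, hd]⟩
  · rintro ⟨hT, E', h, rfl, rfl⟩
    obtain ⟨τ, rfl, hτ⟩ := reachableBySwaps_iff.1 h
    refine ⟨⟨hT, hbound E' c, hbound E' d⟩,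
      fun v => (τ v, w ((E' v).symm c), w ((E' v).symm d)), fun v => ?_, rfl,
      (points_rankings E' c).symm, (points_rankings E' d).symm⟩
    exact mem_map_movesTo.2
      ⟨(Finset.single_le_sum (fun _ _ => Nat.zero_le _) (Finset.mem_univ v)).trans hT, E' v, hτ v,
        rfl, rfl⟩

theorem bestCommittees_eq_topSets_points {γ : ℕ → ℤ} (hγ : ∀ i < m, γ (i + 1) = w i)
    (E : Election m n) (k : ℕ) :
    bestCommittees γ E k = topSets (fun c : Fin m => points w (rankings E) c) k := by
  have hscore : score γ E = fun c : Fin m => (points w (rankings E) c : ℤ) := funext fun c => by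
    simp [score, pos, points_rankings, hγ]
  simp only [bestCommittees_eq_topSets, hscore, topSets, Nat.cast_le]

theorem countP_range (p : ℕ → Prop) [DecidablePred p] :
    (List.range m).countP (p ·) = (Finset.univ.filter fun x : Fin m => p x).card := by
  rw [← List.map_coe_finRange_eq_range, List.countP_map, List.countP_eq_length_filter]
  exact congrArg Multiset.card (Multiset.filter_coe _ _).symm

theorem exists_outcome_iff (hw : ∀ i < m, w i ≤ m) {E : Election m n} {c d : Fin m} {B : ℕ}
    {p : ℕ → ℕ → Prop} :
    (∃ q ∈ outcomes w m (min (n * (m * m)) B) (rankings E) c d, p q.2.1 q.2.2) ↔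
      ∃ (t : ℕ) (E' : Election m n), t ≤ B ∧ ReachableBySwaps t E E' ∧
        p (points w (rankings E') c) (points w (rankings E') d) := by
  simp only [Prod.exists, mem_outcomes hw]
  constructor
  · rintro ⟨t, _, _, ⟨ht, E', h, rfl, rfl⟩, hp⟩
    exact ⟨t, E', ht.trans (min_le_right _ _), h, hp⟩
  · rintro ⟨t, E', ht, h, hp⟩
    obtain ⟨t', ht', hcard, E'', h', hplaces⟩ := exists_reachableBySwaps_le h c d
    refine ⟨t', _, _, ⟨le_min hcard (ht'.trans ht), E'', h', rfl, rfl⟩, ?_⟩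
    simp only [places, Prod.mk.injEq] at hplaces
    simpa only [points_rankings, hplaces] using hp

theorem changeable_iff (hk : k ≤ m) {γ : ℕ → ℤ} (hγ : ∀ i < m, γ (i + 1) = w i)
    (hw : ∀ i < m, w i ≤ m) (E : Election m n) (B : ℕ) :
    Changeable w m k (min (n * (m * m)) B) (rankings E) ↔
      ∃ (t : ℕ) (E' : Election m n), t ≤ B ∧ ReachableBySwaps t E E' ∧
        bestCommittees γ E' k ≠ bestCommittees γ E k := by
  have hk' : k ≤ Fintype.card (Fin m) := by simpa using hk
  simp only [bestCommittees_eq_topSets_points hγ, topSets_ne_iff hk', Changeable, countP_range]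
  constructor
  · rintro ⟨c, hc, d, hd, ⟨hcd, habove, hatLeast⟩, hout⟩
    lift c to Fin m using hc
    lift d to Fin m using hd
    obtain ⟨t, E', ht, h, hle⟩ := (exists_outcome_iff hw
      (p := fun x y => x ≤ y ∧ (points w (rankings E) c = points w (rankings E) d → x < y))).1 hout
    exact ⟨t, E', ht, h, c, d, ⟨fun h => hcd (congrArg _ h), habove, hatLeast⟩, hle⟩
  · rintro ⟨t, E', ht, h, c, d, ⟨hcd, habove, hatLeast⟩, hle⟩
    exact ⟨c, c.is_lt, d, d.is_lt, ⟨fun h => hcd (Fin.ext h), habove, hatLeast⟩,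
      (exists_outcome_iff hw
        (p := fun x y => x ≤ y ∧ (points w (rankings E) c = points w (rankings E) d → x < y))).2
        ⟨t, E', ht, h, hle⟩⟩

end Correctness

open TreeMachine TreeMachine.IsPolyTime

section Complexity

theorem isPolyTime_parseStep :
    IsPolyTime fun x : Γ' × List (List (List Bool)) => parseStep x.1 x.2 := by
  refine symbol_cases (f := fun (x : Γ' × List (List (List Bool))) c => parseStep c x.2)
    (by fun_prop) fun c => ?_
  rcases c with _ | _ | _ | _ | _ <;> simp only [parseStep] <;> fun_prop

theorem size_parseStep_le (c : Γ') (s : List (List (List Bool))) :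
    size (parseStep c s) ≤ size s + 8 := by
  cases c with
  | bit b =>
    have := size_bool_le b
    rcases s with _ | ⟨_ | ⟨x, d⟩, s⟩ <;> simp [parseStep] <;> omega
  | comma => rcases s with _ | ⟨d, s⟩ <;> simp [parseStep]; omega
  | bra => simp [parseStep]; omega
  | ket | blank => simp [parseStep]

@[fun_prop]
theorem isPolyTime_parse : IsPolyTime parse :=
  foldr_of_size_le_add (f := fun _ => parseStep) .id (.const _)
    (isPolyTime_parseStep.comp (f := fun x : List Γ' × Γ' × List (List (List Bool)) => x.2)
      (by fun_prop)) 8 fun _ c s => by simpa using size_parseStep_le c s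

variable {α : Type*} [TreeEncodable α]

@[fun_prop]
theorem isPolyTime_cutValue {L : α → ℕ} {l : α → List Bool} (hL : IsPolyTime L)
    (hl : IsPolyTime l) : IsPolyTime fun a => cutValue (L a) (l a) := by
  obtain ⟨Q, hQ⟩ := hL.exists_size_le
  refine foldr (f := fun a b v => min (L a) (Nat.bit b v)) hl (.const 0) (by fun_prop) Q
    fun a l _ => le_trans ?_ (hQ a)
  cases l <;> simp

variable {w : α → ℕ → ℕ} {m T k : α → ℕ} {c d : α → ℕ}

@[fun_prop]
theorem isPolyTime_points {P : α → List (List ℕ)}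
    (hw : IsPolyTime fun x : α × ℕ => w x.1 x.2) (hP : IsPolyTime P) (hc : IsPolyTime c) :
    IsPolyTime fun a => points (w a) (P a) (c a) := by
  refine IsPolyTime.sum (map hP ?_)
  exact hw.comp (f := fun x : α × List ℕ => (x.1, x.2.idxOf (c x.1))) (by fun_prop)

@[fun_prop]
theorem isPolyTimePred_placeSwap {p q : α → ℕ × ℕ} (hm : IsPolyTime m) (hp : IsPolyTime p)
    (hq : IsPolyTime q) : IsPolyTimePred fun a => PlaceSwap (m a) (p a) (q a) :=
  .exists_lt (by fun_prop) (.prod_eq (by fun_prop) (by fun_prop))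

@[fun_prop]
theorem isPolyTime_placesAfter {p : α → ℕ × ℕ} (hm : IsPolyTime m) (hT : IsPolyTime T)
    (hp : IsPolyTime p) : IsPolyTime fun a => placesAfter (m a) (T a) (p a) :=
  iterate_filter (P := fun a X q => ∃ p ∈ X, PlaceSwap (m a) p q) hT (by fun_prop) (by fun_prop)
    (by fun_prop)

@[fun_prop]
theorem isPolyTime_movesTo {p : α → ℕ × ℕ} (hm : IsPolyTime m) (hT : IsPolyTime T)
    (hp : IsPolyTime p) : IsPolyTime fun a => movesTo (m a) (T a) (p a) := by
  unfold movesTo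
  fun_prop

@[fun_prop]
theorem isPolyTime_outcomes {P : α → List (List ℕ)}
    (hw : IsPolyTime fun x : α × ℕ => w x.1 x.2) (hm : IsPolyTime m) (hT : IsPolyTime T)
    (hP : IsPolyTime P) (hc : IsPolyTime c) (hd : IsPolyTime d) :
    IsPolyTime fun a => outcomes (w a) (m a) (T a) (P a) (c a) (d a) := by
  unfold outcomes boundedSums outcomeBox
  refine foldr_filter (P := fun _ X S q => ∃ p ∈ S, ∃ o ∈ X, q = o + p) ?_ (by fun_prop)
    (by fun_prop) ?_
  · have hweight {i : (α × List ℕ) × ℕ × ℕ × ℕ → ℕ} (hi : IsPolyTime i) :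
        IsPolyTime fun x => w x.1.1 (i x) :=
      hw.comp (f := fun x => (x.1.1, i x)) (by fun_prop)
    exact map hP (map (by fun_prop)
      (.pair (by fun_prop) (.pair (hweight (by fun_prop)) (hweight (by fun_prop)))))
  · refine .bex (by fun_prop) (.bex (by fun_prop) ?_)
    simp only [Prod.ext_iff, Prod.fst_add, Prod.snd_add]
    fun_prop

theorem isPolyTimePred_changeable {P : α → List (List ℕ)}
    (hw : IsPolyTime fun x : α × ℕ => w x.1 x.2) (hm : IsPolyTime m) (hk : IsPolyTime k)
    (hT : IsPolyTime T) (hP : IsPolyTime P) :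
    IsPolyTimePred fun a => Changeable (w a) (m a) (k a) (T a) (P a) := by
  unfold Changeable
  fun_prop

theorem isPolyTimePred_changeableBlocks {w : ℕ → ℕ → ℕ → ℕ}
    (hw : IsPolyTime fun x : ℕ × ℕ × ℕ => w x.1 x.2.1 x.2.2) :
    IsPolyTimePred (ChangeableBlocks w) := by
  unfold ChangeableBlocks
  refine isPolyTimePred_changeable ?_ (by fun_prop) (by fun_prop) (by fun_prop) (by fun_prop)
  exact hw.comp (f := fun x : List (List (List Bool)) × ℕ =>
    (((x.1.headD []).headD []).length, ((x.1.headD []).tail.headD []).length, x.2)) (by fun_prop)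

theorem polyTimeDecidable_robustnessRadius {R : Rule} {γ : ℕ → ℕ → ℕ → ℤ} {w : ℕ → ℕ → ℕ → ℕ}
    (hR : ∀ {m n : ℕ} (E : Election m n) (k : ℕ), R E k = bestCommittees (γ m k) E k)
    (hγ : ∀ m k, ∀ i < m, γ m k (i + 1) = w m k i) (hw : ∀ m k, ∀ i < m, w m k i ≤ m)
    (hpoly : IsPolyTime fun x : ℕ × ℕ × ℕ => w x.1 x.2.1 x.2.2) :
    PolyTimeDecidable encodeInstance (RobustnessRadius R) := by
  refine IsPolyTimePred.polyTimeDecidable (Q := fun l => ChangeableBlocks w (parse l))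
    (.comp (isPolyTimePred_changeableBlocks hpoly) isPolyTime_parse) fun I => ?_
  rw [changeableBlocks_parse, changeable_iff I.k_le (hγ I.m I.k) (hw I.m I.k)]
  simp only [RobustnessRadius, hR]

theorem polyTimeDecidable_sntv : PolyTimeDecidable encodeInstance (RobustnessRadius sntv) :=
  polyTimeDecidable_robustnessRadius (γ := fun _ _ => approval 1)
    (w := fun _ _ i => if i < 1 then 1 else 0) (fun _ _ => rfl)
    (fun _ _ _ _ => by simp [approval]) (fun _ _ _ _ => by split_ifs <;> omega) (by fun_prop)

theorem polyTimeDecidable_bloc : PolyTimeDecidable encodeInstance (RobustnessRadius bloc) :=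
  polyTimeDecidable_robustnessRadius (γ := fun _ k => approval k)
    (w := fun _ k i => if i < k then 1 else 0) (fun _ _ => rfl)
    (fun _ _ _ _ => by simp [approval]) (fun _ _ _ _ => by split_ifs <;> omega)
    (by fun_prop)

theorem polyTimeDecidable_kBorda : PolyTimeDecidable encodeInstance (RobustnessRadius kBorda) :=
  polyTimeDecidable_robustnessRadius (γ := fun m _ => borda m) (w := fun m _ i => m - (i + 1))
    (fun _ _ => rfl) (fun _ _ _ _ => by simp only [borda]; omega) (fun _ _ _ _ => by omega)
    (by fun_prop)

end Complexity

end Multiwinner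

theorem mainTheorem7 :
    Multiwinner.PolyTimeDecidable Multiwinner.encodeInstance
        (Multiwinner.RobustnessRadius Multiwinner.sntv) ∧
      Multiwinner.PolyTimeDecidable Multiwinner.encodeInstance
        (Multiwinner.RobustnessRadius Multiwinner.bloc) ∧
      Multiwinner.PolyTimeDecidable Multiwinner.encodeInstance
        (Multiwinner.RobustnessRadius Multiwinner.kBorda) :=
  ⟨Multiwinner.polyTimeDecidable_sntv, Multiwinner.polyTimeDecidable_bloc,
    Multiwinner.polyTimeDecidable_kBorda⟩
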